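/- Let $n\ge 4$ be an even integer, let $u\in C^\infty(\mathbb{R}^n)$ be real valued, and let $g=e^{2u}|dx|^2$ be the corresponding conformal metric on $\mathbb{R}^n$ (not assumed complete). Let $R_g$ be its scalar curvature, and let $Q$ be its Q-curvature, i.e. the function determined by $$(-\Delta)^{n/2}u=Q\,e^{nu}\qquad\text{on }\mathbb{R}^n ,$$ where $\Delta$ is the Euclidean Laplacian. Assume that $g$ has finite total Q-curvature, that is, $Qe^{nu}\in L^1(\mathbb{R}^n)$. Write $R_g^-=\max\{-R_g,0\}$ and let $|\mathbb{S}^n|$ be the volume of the standard unit $n$-sphere in $\mathbb{R}^{n+1}$. 1. If $\int_{\mathbb{R}^n}(R_g^-)^{n/2}e^{nu}\,dx<+\infty$, then $$0\le\int_{\mathbb{R}^n}Qe^{nu}\,dx\le (n-1)!\,|\mathbb{S}^n| .$$ 2. If $\int_{\mathbb{R}^n}|R_g|^{n/2}e^{nu}\,dx<+\infty$, then $$\int_{\mathbb{R}^n}Qe^{nu}\,dx=0\quad\text{or}\quad\int_{\mathbb{R}^n}Qe^{nu}\,dx=(n-1)!\,|\mathbb{S}^n| .$$ If in addition the volume is finite,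 i.e. $e^{nu}\in L^1(\mathbb{R}^n)$, then $$\int_{\mathbb{R}^n}Qe^{nu}\,dx=(n-1)!\,|\mathbb{S}^n| .$$ -/

import Mathlib

open MeasureTheory
open scoped ContDiff Laplacian

noncomputable section

namespace ConformalQ

/-- The `i`-th partial derivative of a real function on `ℝⁿ`. -/
def partialDeriv {n : ℕ} (i : Fin n) (f : EuclideanSpace ℝ (Fin n) → ℝ)
    (x : EuclideanSpace ℝ (Fin n)) : ℝ :=
  fderiv ℝ f x (EuclideanSpace.single i 1)

/-- The Christoffel symbol `Γᵏᵢⱼ = ½ ∑ₗ gᵏˡ (∂ᵢ gⱼₗ + ∂ⱼ gᵢₗ - ∂ₗ gᵢⱼ)` of a metric `g` on `ℝⁿ`,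
given by its matrix in the standard coordinates. -/
def christoffel {n : ℕ} (g : EuclideanSpace ℝ (Fin n) → Matrix (Fin n) (Fin n) ℝ)
    (k i j : Fin n) (x : EuclideanSpace ℝ (Fin n)) : ℝ :=
  (1 / 2) * ∑ l, (g x)⁻¹ k l *
    (partialDeriv i (fun y => g y j l) x + partialDeriv j (fun y => g y i l) x
      - partialDeriv l (fun y => g y i j) x)

/-- The Ricci curvature
`Rᵢⱼ = ∑ₖ (∂ₖ Γᵏᵢⱼ - ∂ⱼ Γᵏᵢₖ + ∑ₗ (Γᵏₖₗ Γˡᵢⱼ - Γᵏⱼₗ Γˡᵢₖ))`. -/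
def ricci {n : ℕ} (g : EuclideanSpace ℝ (Fin n) → Matrix (Fin n) (Fin n) ℝ)
    (i j : Fin n) (x : EuclideanSpace ℝ (Fin n)) : ℝ :=
  ∑ k, (partialDeriv k (christoffel g k i j) x - partialDeriv j (christoffel g k i k) x
    + ∑ l, (christoffel g k k l x * christoffel g l i j x
      - christoffel g k j l x * christoffel g l i k x))

/-- The scalar curvature `R_g = ∑ᵢⱼ gⁱʲ Rᵢⱼ` (positive for round spheres). -/
def scalarCurvature {n : ℕ} (g : EuclideanSpace ℝ (Fin n) → Matrix (Fin n) (Fin n) ℝ)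
    (x : EuclideanSpace ℝ (Fin n)) : ℝ :=
  ∑ i, ∑ j, (g x)⁻¹ i j * ricci g i j x

/-- The conformally flat metric `g = e^{2u} |dx|²` on `ℝⁿ`. -/
def conformalMetric {n : ℕ} (u : EuclideanSpace ℝ (Fin n) → ℝ)
    (x : EuclideanSpace ℝ (Fin n)) : Matrix (Fin n) (Fin n) ℝ :=
  Real.exp (2 * u x) • (1 : Matrix (Fin n) (Fin n) ℝ)

/-- The Q-curvature of `g = e^{2u} |dx|²` on `ℝⁿ`, `n` even: the function `Q` determined by
the conformally invariant equation `(-Δ)^{n/2} u = Q e^{nu}`, where `Δ` is the Euclidean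
Laplacian and `(-Δ)^{n/2}` is the `n/2`-th iterate of `-Δ`. -/
def qCurvature {n : ℕ} (u : EuclideanSpace ℝ (Fin n) → ℝ)
    (x : EuclideanSpace ℝ (Fin n)) : ℝ :=
  ((fun f : EuclideanSpace ℝ (Fin n) → ℝ => -(Δ f))^[n / 2] u) x * Real.exp (-(n * u x))

/-- The volume `|𝕊ⁿ|` of the unit sphere of `ℝⁿ⁺¹` for its standard surface measure. -/
def sphereVolume (n : ℕ) : ℝ :=
  (volume : Measure (EuclideanSpace ℝ (Fin (n + 1)))).toSphere.real Set.univ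

end ConformalQ

end

/-!
Write `n = 2m` and let `α` be the total Q-curvature divided by `(n - 1)! |𝕊ⁿ| / 2`, the total mass
of `(-Δ)ᵐ (-log ‖x‖)`. A computation gives
`-e²ᵘ R_g / (2 (n - 1)) = Δu + (n - 2) / 2 * ‖∇u‖²`. Testing this against cutoff functions, the
scale-invariant bound on `R_g⁻` bounds `‖∇u‖²` in the mean on all balls, at their natural scale.
This leaves no room for a polyharmonic part of `∇u`, which is therefore the convolution of
`(-Δ)ᵐ u` with the gradient of the logarithmic kernel. Consequently the gradients of the blow-downs
`u (R ·)` converge, in `L²` on an annulus, to the gradient of `-α log ‖ξ‖` as `R → ∞`.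

For `-α log ‖ξ‖` the right-hand side of the scalar curvature equation is
`(n - 2) / 2 * α (α - 2) / ‖ξ‖²`, while the tail of the convergent integral of `(R_g⁻)ᵐ e^{nu}`, or
of `|R_g|ᵐ e^{nu}`, vanishes in the limit. Hence `α (α - 2) ≤ 0` in the first case and
`α (α - 2) = 0` in the second. If `α = 0`, then annular averages of `u (R ·)` decrease more slowly
than `-ε log R` for every `ε > 0`, so by Jensen's inequality the volume is infinite.
-/

namespace ConformalQ

open Filter Topology Set

section Calculus

variable {n : ℕ} {f g : EuclideanSpace ℝ (Fin n) → ℝ}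

theorem contDiff_partialDeriv {k : WithTop ℕ∞} (hf : ContDiff ℝ (k + 1) f) (i : Fin n) :
    ContDiff ℝ k (partialDeriv i f) :=
  (hf.fderiv_right le_rfl).clm_apply contDiff_const

theorem continuous_partialDeriv (hf : ContDiff ℝ 1 f) (i : Fin n) :
    Continuous (partialDeriv i f) :=
  (contDiff_partialDeriv (k := 0) hf i).continuous

theorem hasCompactSupport_partialDeriv (hf : HasCompactSupport f) (i : Fin n) :
    HasCompactSupport (partialDeriv i f) :=
  hf.fderiv_apply ℝ (EuclideanSpace.single i 1)

theorem partialDeriv_neg (i : Fin n) : partialDeriv i (-f) = -partialDeriv i f := by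
  ext x
  simp [partialDeriv, fderiv_neg]

theorem partialDeriv_sum {ι : Type*} (s : Finset ι) {F : ι → EuclideanSpace ℝ (Fin n) → ℝ}
    (hF : ∀ j ∈ s, Differentiable ℝ (F j)) (i : Fin n) :
    partialDeriv i (fun x => ∑ j ∈ s, F j x) = fun x => ∑ j ∈ s, partialDeriv i (F j) x := by
  ext x
  simp only [partialDeriv]
  rw [fderiv_fun_sum fun j hj => hF j hj x]
  simp

theorem partialDeriv_mul (hf : Differentiable ℝ f) (hg : Differentiable ℝ g) (i : Fin n)
    (x : EuclideanSpace ℝ (Fin n)) :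
    partialDeriv i (fun x => f x * g x) x =
      f x * partialDeriv i g x + partialDeriv i f x * g x := by
  simp only [partialDeriv]
  rw [fderiv_fun_mul (hf x) (hg x)]
  simp [mul_comm]

theorem fderiv_eq_sum_partialDeriv (x v : EuclideanSpace ℝ (Fin n)) :
    fderiv ℝ f x v = ∑ i, partialDeriv i f x * v i := by
  conv_lhs => rw [← (EuclideanSpace.basisFun (Fin n) ℝ).sum_repr v]
  simp [partialDeriv, mul_comm]

theorem partialDeriv_partialDeriv (hf : ContDiff ℝ 2 f) (i j : Fin n)
    (x : EuclideanSpace ℝ (Fin n)) :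
    partialDeriv i (partialDeriv j f) x =
      fderiv ℝ (fderiv ℝ f) x (EuclideanSpace.single i 1) (EuclideanSpace.single j 1) := by
  have h : DifferentiableAt ℝ (fderiv ℝ f) x :=
    (hf.fderiv_right (m := 1) (by norm_num)).differentiable one_ne_zero x
  unfold partialDeriv
  rw [fderiv_clm_apply h (differentiableAt_const _)]
  simp

theorem partialDeriv_comm (hf : ContDiff ℝ 2 f) (i j : Fin n) :
    partialDeriv i (partialDeriv j f) = partialDeriv j (partialDeriv i f) := by
  ext x
  rw [partialDeriv_partialDeriv hf, partialDeriv_partialDeriv hf]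
  exact hf.contDiffAt.isSymmSndFDerivAt minSmoothness_of_isRCLikeNormedField.le _ _

theorem laplacian_eq_sum_partialDeriv (hf : ContDiff ℝ 2 f) :
    Δ f = fun x => ∑ i, partialDeriv i (partialDeriv i f) x := by
  rw [InnerProductSpace.laplacian_eq_iteratedFDeriv_orthonormalBasis f
    (EuclideanSpace.basisFun (Fin n) ℝ)]
  ext x
  simp [partialDeriv_partialDeriv hf, iteratedFDeriv_two_apply]

theorem contDiff_laplacian (hf : ContDiff ℝ ∞ f) : ContDiff ℝ ∞ (Δ f) := by
  rw [laplacian_eq_sum_partialDeriv (contDiff_infty.1 hf 2)]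
  exact ContDiff.sum fun i _ => contDiff_partialDeriv (contDiff_partialDeriv hf i) i

theorem hasCompactSupport_laplacian (hf : HasCompactSupport f) : HasCompactSupport (Δ f) := by
  refine hf.mono' fun x hx => ?_
  contrapose! hx
  have h : f =ᶠ[𝓝 x] fun _ => (0 : ℝ) := notMem_tsupport_iff_eventuallyEq.1 hx
  simp [(InnerProductSpace.laplacian_congr_nhds h).eq_of_nhds]

theorem partialDeriv_laplacian (hf : ContDiff ℝ ∞ f) (i : Fin n) :
    partialDeriv i (Δ f) = Δ (partialDeriv i f) := by
  have hd (j : Fin n) : ContDiff ℝ ∞ (partialDeriv j f) := contDiff_partialDeriv hf j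
  rw [laplacian_eq_sum_partialDeriv (contDiff_infty.1 hf 2),
    laplacian_eq_sum_partialDeriv (contDiff_infty.1 (hd i) 2),
    partialDeriv_sum _ fun j _ =>
      (contDiff_infty.1 (contDiff_partialDeriv (hd j) j) 1).differentiable one_ne_zero]
  ext x
  refine Finset.sum_congr rfl fun j _ => ?_
  rw [partialDeriv_comm (contDiff_infty.1 (hd j) 2) i j,
    partialDeriv_comm (contDiff_infty.1 hf 2) i j]

/-- The polyharmonic operator `(-Δ)ᵏ`. -/
noncomputable def polyLaplacian (k : ℕ) (f : EuclideanSpace ℝ (Fin n) → ℝ) :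
    EuclideanSpace ℝ (Fin n) → ℝ :=
  (fun f : EuclideanSpace ℝ (Fin n) → ℝ => -(Δ f))^[k] f

theorem polyLaplacian_succ (k : ℕ) : polyLaplacian (k + 1) f = polyLaplacian k (-(Δ f)) := rfl

theorem polyLaplacian_succ' (k : ℕ) : polyLaplacian (k + 1) f = -(Δ (polyLaplacian k f)) :=
  Function.iterate_succ_apply' _ _ _

theorem contDiff_polyLaplacian (hf : ContDiff ℝ ∞ f) (k : ℕ) :
    ContDiff ℝ ∞ (polyLaplacian k f) := by
  induction k with
  | zero => exact hf
  | succ k ih => rw [polyLaplacian_succ']; exact (contDiff_laplacian ih).neg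

theorem hasCompactSupport_polyLaplacian (hf : HasCompactSupport f) (k : ℕ) :
    HasCompactSupport (polyLaplacian k f) := by
  induction k with
  | zero => exact hf
  | succ k ih => rw [polyLaplacian_succ']; exact (hasCompactSupport_laplacian ih).neg

theorem partialDeriv_polyLaplacian (hf : ContDiff ℝ ∞ f) (i : Fin n) (k : ℕ) :
    partialDeriv i (polyLaplacian k f) = polyLaplacian k (partialDeriv i f) := by
  induction k with
  | zero => rfl
  | succ k ih =>
    rw [polyLaplacian_succ', polyLaplacian_succ', partialDeriv_neg,
      partialDeriv_laplacian (contDiff_polyLaplacian hf k), ih]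

theorem integral_mul_partialDeriv (hf : ContDiff ℝ 1 f) (hfs : HasCompactSupport f)
    (hg : ContDiff ℝ 1 g) (i : Fin n) :
    ∫ x, f x * partialDeriv i g x = -∫ x, partialDeriv i f x * g x :=
  integral_mul_fderiv_eq_neg_fderiv_mul_of_integrable
    (((continuous_partialDeriv hf i).mul hg.continuous).integrable_of_hasCompactSupport
      (hasCompactSupport_partialDeriv hfs i).mul_right)
    ((hf.continuous.mul (continuous_partialDeriv hg i)).integrable_of_hasCompactSupport
      hfs.mul_right)
    ((hf.continuous.mul hg.continuous).integrable_of_hasCompactSupport hfs.mul_right)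
    (fun x _ => hf.differentiable one_ne_zero x) (fun x _ => hg.differentiable one_ne_zero x)

theorem integral_mul_laplacian (hf : ContDiff ℝ 1 f) (hfs : HasCompactSupport f)
    (hg : ContDiff ℝ 2 g) :
    ∫ x, f x * Δ g x = -∑ i, ∫ x, partialDeriv i f x * partialDeriv i g x := by
  have hd (i : Fin n) : ContDiff ℝ 1 (partialDeriv i g) := contDiff_partialDeriv (k := 1) hg i
  simp only [laplacian_eq_sum_partialDeriv hg, Finset.mul_sum]
  rw [integral_finsetSum, ← Finset.sum_neg_distrib]
  · exact Finset.sum_congr rfl fun i _ => integral_mul_partialDeriv hf hfs (hd i) i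
  · exact fun i _ => (hf.continuous.mul
      (continuous_partialDeriv (hd i) i)).integrable_of_hasCompactSupport hfs.mul_right

theorem integral_mul_laplacian_comm (hf : ContDiff ℝ 2 f) (hfs : HasCompactSupport f)
    (hg : ContDiff ℝ 2 g) : ∫ x, f x * Δ g x = ∫ x, Δ f x * g x := by
  have hd (i : Fin n) : ContDiff ℝ 1 (partialDeriv i f) := contDiff_partialDeriv (k := 1) hf i
  have hds (i : Fin n) := hasCompactSupport_partialDeriv hfs i
  have hg₁ : ContDiff ℝ 1 g := hg.of_le one_le_two
  rw [integral_mul_laplacian (hf.of_le one_le_two) hfs hg]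
  simp only [laplacian_eq_sum_partialDeriv hf, Finset.sum_mul]
  rw [integral_finsetSum, ← Finset.sum_neg_distrib]
  · refine Finset.sum_congr rfl fun i _ => ?_
    rw [integral_mul_partialDeriv (hd i) (hds i) hg₁ i, neg_neg]
  · exact fun i _ => ((continuous_partialDeriv (hd i) i).mul
      hg.continuous).integrable_of_hasCompactSupport
        (hasCompactSupport_partialDeriv (hds i) i).mul_right

theorem integral_mul_polyLaplacian (hf : ContDiff ℝ ∞ f) (hfs : HasCompactSupport f)
    (hg : ContDiff ℝ ∞ g) (k : ℕ) :
    ∫ x, f x * polyLaplacian k g x = ∫ x, polyLaplacian k f x * g x := by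
  induction k generalizing g with
  | zero => rfl
  | succ k ih =>
    have := integral_mul_laplacian_comm (contDiff_infty.1 (contDiff_polyLaplacian hf k) 2)
      (hasCompactSupport_polyLaplacian hfs k) (contDiff_infty.1 hg 2)
    rw [polyLaplacian_succ, ih (g := -(Δ g)) (contDiff_laplacian hg).neg, polyLaplacian_succ']
    simp only [Pi.neg_apply, mul_neg, neg_mul, integral_neg, this]

theorem integral_partialDeriv_mul_polyLaplacian (hf : ContDiff ℝ ∞ f) (hfs : HasCompactSupport f)
    (hg : ContDiff ℝ ∞ g) (k : ℕ) (i : Fin n) :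
    ∫ x, partialDeriv i f x * polyLaplacian k g x =
      -∫ x, polyLaplacian k f x * partialDeriv i g x := by
  rw [integral_mul_polyLaplacian (contDiff_partialDeriv hf i)
      (hasCompactSupport_partialDeriv hfs i) hg, ← partialDeriv_polyLaplacian hf,
    integral_mul_partialDeriv (contDiff_infty.1 (contDiff_polyLaplacian hf k) 1)
      (hasCompactSupport_polyLaplacian hfs k) (contDiff_infty.1 hg 1), neg_neg]

/-- The rescaling `z ↦ f (x + R z)` of a function about the point `x`. -/
def rescale (f : EuclideanSpace ℝ (Fin n) → ℝ) (x : EuclideanSpace ℝ (Fin n)) (R : ℝ)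
    (z : EuclideanSpace ℝ (Fin n)) : ℝ := f (x + R • z)

theorem contDiff_rescale {k : WithTop ℕ∞} (hf : ContDiff ℝ k f) (x : EuclideanSpace ℝ (Fin n))
    (R : ℝ) : ContDiff ℝ k (rescale f x R) := by
  unfold rescale
  fun_prop

theorem partialDeriv_rescale (x : EuclideanSpace ℝ (Fin n)) (R : ℝ) (i : Fin n) :
    partialDeriv i (rescale f x R) = R • rescale (partialDeriv i f) x R := by
  ext z
  have h := fderiv_comp_smul (𝕜 := ℝ) (f := fun y => f (x + y)) (x := z) R
  rw [fderiv_comp_add_left] at h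
  exact congrArg (· (EuclideanSpace.single i 1)) h

theorem laplacian_rescale (hf : ContDiff ℝ 2 f) (x : EuclideanSpace ℝ (Fin n)) (R : ℝ) :
    Δ (rescale f x R) = R ^ 2 • rescale (Δ f) x R := by
  have hd (i : Fin n) : Differentiable ℝ (rescale (partialDeriv i f) x R) :=
    (contDiff_rescale (contDiff_partialDeriv (k := 1) hf i) x R).differentiable one_ne_zero
  have h (i : Fin n) (z : EuclideanSpace ℝ (Fin n)) :
      partialDeriv i (R • rescale (partialDeriv i f) x R) z =
        R ^ 2 * rescale (partialDeriv i (partialDeriv i f)) x R z := by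
    calc partialDeriv i (R • rescale (partialDeriv i f) x R) z
        = R * partialDeriv i (rescale (partialDeriv i f) x R) z := by
          rw [partialDeriv, fderiv_const_smul (hd i z)]; rfl
      _ = R ^ 2 * rescale (partialDeriv i (partialDeriv i f)) x R z := by
          rw [partialDeriv_rescale, Pi.smul_apply, smul_eq_mul]; ring
  rw [laplacian_eq_sum_partialDeriv (contDiff_rescale hf x R), laplacian_eq_sum_partialDeriv hf]
  ext z
  simp [partialDeriv_rescale, h, rescale, Finset.mul_sum]

theorem polyLaplacian_translate (hf : ContDiff ℝ ∞ f) (x : EuclideanSpace ℝ (Fin n)) (k : ℕ) :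
    polyLaplacian k (rescale f x 1) = rescale (polyLaplacian k f) x 1 := by
  induction k with
  | zero => rfl
  | succ k ih =>
    rw [polyLaplacian_succ', polyLaplacian_succ', ih,
      laplacian_rescale (contDiff_infty.1 (contDiff_polyLaplacian hf k) 2)]
    ext z
    simp [rescale]

end Calculus

section Curvature

variable {n : ℕ} {u : EuclideanSpace ℝ (Fin n) → ℝ}

/-- The squared norm `|∇u|²` of the Euclidean gradient. -/
noncomputable def gradSq (u : EuclideanSpace ℝ (Fin n) → ℝ) (x : EuclideanSpace ℝ (Fin n)) : ℝ :=
  ∑ i, partialDeriv i u x ^ 2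

/-- The operator `Δu + (n - 2) / 2 |∇u|²`, which is `-e^{2u} R_g / (2 (n - 1))` for the scalar
curvature `R_g` of `g = e^{2u} |dx|²`. -/
noncomputable def confLaplacian (u : EuclideanSpace ℝ (Fin n) → ℝ)
    (x : EuclideanSpace ℝ (Fin n)) : ℝ :=
  Δ u x + (n - 2) / 2 * gradSq u x

theorem gradSq_nonneg (x : EuclideanSpace ℝ (Fin n)) : 0 ≤ gradSq u x :=
  Finset.sum_nonneg fun _ _ => sq_nonneg _

theorem continuous_gradSq (hu : ContDiff ℝ 1 u) : Continuous (gradSq u) :=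
  continuous_finsetSum _ fun i _ => (continuous_partialDeriv hu i).pow 2

theorem continuous_laplacian (hu : ContDiff ℝ 2 u) : Continuous (Δ u) := by
  rw [laplacian_eq_sum_partialDeriv hu]
  exact continuous_finsetSum _ fun i _ =>
    continuous_partialDeriv (contDiff_partialDeriv (k := 1) hu i) i

theorem continuous_confLaplacian (hu : ContDiff ℝ 2 u) : Continuous (confLaplacian u) :=
  (continuous_laplacian hu).add ((continuous_gradSq (hu.of_le one_le_two)).const_mul _)

theorem gradSq_rescale (x : EuclideanSpace ℝ (Fin n)) (R : ℝ) (z : EuclideanSpace ℝ (Fin n)) :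
    gradSq (rescale u x R) z = R ^ 2 * gradSq u (x + R • z) := by
  simp [gradSq, partialDeriv_rescale, rescale, mul_pow, Finset.mul_sum]

theorem confLaplacian_rescale (hu : ContDiff ℝ 2 u) (x : EuclideanSpace ℝ (Fin n)) (R : ℝ)
    (z : EuclideanSpace ℝ (Fin n)) :
    confLaplacian (rescale u x R) z = R ^ 2 * confLaplacian u (x + R • z) := by
  simp only [confLaplacian, laplacian_rescale hu, gradSq_rescale, Pi.smul_apply, rescale,
    smul_eq_mul]
  ring

theorem conformalMetric_inv_apply (x : EuclideanSpace ℝ (Fin n)) (i j : Fin n) :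
    (conformalMetric u x)⁻¹ i j = if i = j then Real.exp (-(2 * u x)) else 0 := by
  have h : (conformalMetric u x)⁻¹ = Real.exp (-(2 * u x)) • (1 : Matrix (Fin n) (Fin n) ℝ) := by
    refine Matrix.inv_eq_left_inv ?_
    rw [conformalMetric, smul_mul_smul_comm, ← Real.exp_add]
    simp
  rw [h, Matrix.smul_apply, Matrix.one_apply]
  split_ifs <;> simp

theorem partialDeriv_conformalMetric (hu : Differentiable ℝ u) (x : EuclideanSpace ℝ (Fin n))
    (i j l : Fin n) :
    partialDeriv i (fun y => conformalMetric u y j l) x =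
      if j = l then 2 * partialDeriv i u x * Real.exp (2 * u x) else 0 := by
  rcases eq_or_ne j l with rfl | hjl
  · have he := ((hu x).hasFDerivAt.const_mul 2).exp
    simp only [partialDeriv, conformalMetric, Matrix.smul_apply, Matrix.one_apply_eq, smul_eq_mul,
      mul_one, he.fderiv, if_true, smul_apply]
    ring
  · simp [partialDeriv, conformalMetric, hjl]

theorem christoffel_conformalMetric (hu : Differentiable ℝ u) (k i j : Fin n) :
    christoffel (conformalMetric u) k i j =
      fun x => (if j = k then partialDeriv i u x else 0)
        + (if i = k then partialDeriv j u x else 0)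
        - (if i = j then partialDeriv k u x else 0) := by
  ext x
  have hexp : Real.exp (-(2 * u x)) * Real.exp (2 * u x) = 1 := by simp [← Real.exp_add]
  have hite (p : Prop) [Decidable p] (a : ℝ) : (if p then 2 * a * Real.exp (2 * u x) else 0) =
      2 * Real.exp (2 * u x) * (if p then a else 0) := by
    split_ifs <;> ring
  simp only [christoffel, conformalMetric_inv_apply, partialDeriv_conformalMetric hu, ite_mul,
    zero_mul, Finset.sum_ite_eq, Finset.mem_univ, if_true, hite]
  linear_combination ((if j = k then partialDeriv i u x else 0)
        + (if i = k then partialDeriv j u x else 0)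
        - (if i = j then partialDeriv k u x else 0)) * hexp

theorem partialDeriv_christoffel_conformalMetric (hu : ContDiff ℝ 2 u) (l k i j : Fin n)
    (x : EuclideanSpace ℝ (Fin n)) :
    partialDeriv l (christoffel (conformalMetric u) k i j) x =
      (if j = k then partialDeriv l (partialDeriv i u) x else 0)
        + (if i = k then partialDeriv l (partialDeriv j u) x else 0)
        - (if i = j then partialDeriv l (partialDeriv k u) x else 0) := by
  have hterm (p : Prop) [Decidable p] (a : Fin n) :
      HasFDerivAt (fun x => if p then partialDeriv a u x else 0)
        (if p then fderiv ℝ (partialDeriv a u) x else 0) x := by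
    split_ifs
    · exact ((contDiff_partialDeriv (k := 1) hu a).differentiable one_ne_zero x).hasFDerivAt
    · exact hasFDerivAt_const _ _
  rw [christoffel_conformalMetric (hu.differentiable two_ne_zero)]
  refine (congrArg (· (EuclideanSpace.single l 1))
    (((hterm (j = k) i).add (hterm (i = k) j)).sub (hterm (i = j) k)).fderiv).trans ?_
  split_ifs <;> simp [partialDeriv]

theorem ricci_conformalMetric_diag (hu : ContDiff ℝ 2 u) (i : Fin n)
    (x : EuclideanSpace ℝ (Fin n)) :
    ricci (conformalMetric u) i i x =
      (2 - n) * partialDeriv i (partialDeriv i u) x - Δ u x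
        + (n - 2) * partialDeriv i u x ^ 2 + (2 - n) * gradSq u x := by
  have hquad (k l : Fin n) :
      christoffel (conformalMetric u) k k l x * christoffel (conformalMetric u) l i i x
      - christoffel (conformalMetric u) k i l x * christoffel (conformalMetric u) l i k x =
      ((if l = i then 2 * (partialDeriv i u x) ^ 2 else 0) - (partialDeriv l u x) ^ 2)
      - ((if l = k then (partialDeriv i u x) ^ 2 else 0)
        - (if k = i then (partialDeriv l u x) ^ 2 else 0)
        - (if l = i then (partialDeriv k u x) ^ 2 else 0)
        + (if l = i then (if k = i then 2 * (partialDeriv i u x) ^ 2 else 0) else 0)) := by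
    simp only [christoffel_conformalMetric (hu.differentiable two_ne_zero)]
    by_cases hki : k = i <;> by_cases hli : l = i <;> by_cases hlk : l = k <;>
      simp_all [eq_comm] <;> ring
  have hderiv (k : Fin n) : partialDeriv k (christoffel (conformalMetric u) k i i) x
      - partialDeriv i (christoffel (conformalMetric u) k i k) x =
      (if k = i then 2 * partialDeriv i (partialDeriv i u) x else 0)
        - partialDeriv k (partialDeriv k u) x - partialDeriv i (partialDeriv i u) x := by
    simp only [partialDeriv_christoffel_conformalMetric hu]
    by_cases hki : k = i <;> simp_all [eq_comm]
    ring
  have hsum : ∑ k : Fin n, ∑ l : Fin n, (if k = i then (partialDeriv l u x) ^ 2 else 0) =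
      ∑ l, (partialDeriv l u x) ^ 2 := by
    rw [Finset.sum_comm]
    simp
  simp only [ricci, hquad, hderiv, Finset.sum_add_distrib, Finset.sum_sub_distrib,
    Finset.sum_ite_eq', Finset.mem_univ, if_true, Finset.sum_const, Finset.card_univ,
    Fintype.card_fin, nsmul_eq_mul, hsum, laplacian_eq_sum_partialDeriv hu, gradSq]
  ring

theorem scalarCurvature_conformalMetric (hu : ContDiff ℝ 2 u) (x : EuclideanSpace ℝ (Fin n)) :
    scalarCurvature (conformalMetric u) x =
      -(2 * (n - 1)) * Real.exp (-(2 * u x)) * confLaplacian u x := by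
  simp only [scalarCurvature, conformalMetric_inv_apply, ite_mul, zero_mul, Finset.sum_ite_eq,
    Finset.mem_univ, if_true, ricci_conformalMetric_diag hu, ← Finset.mul_sum,
    Finset.sum_add_distrib, Finset.sum_sub_distrib, Finset.sum_const, Finset.card_univ,
    Fintype.card_fin, nsmul_eq_mul, confLaplacian, gradSq, laplacian_eq_sum_partialDeriv hu]
  ring

end Curvature

section Radial

variable {n : ℕ} {g g₁ g₂ : ℝ → ℝ} {U : Set ℝ}

/-- The radial function `z ↦ g (‖z‖²)` on `ℝⁿ`; the squared norm is used because it is smooth at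
the origin. -/
noncomputable def radial (n : ℕ) (g : ℝ → ℝ) (z : EuclideanSpace ℝ (Fin n)) : ℝ := g (‖z‖ ^ 2)

/-- The Euclidean Laplacian of `ℝⁿ` on radial functions, in the variable `s = ‖z‖²`. -/
noncomputable def radialLaplacian (n : ℕ) (g : ℝ → ℝ) (s : ℝ) : ℝ :=
  4 * s * deriv (deriv g) s + 2 * n * deriv g s

/-- The polyharmonic operator `(-Δ)ᵏ` of `ℝⁿ` on radial functions, in the variable `s = ‖z‖²`. -/
noncomputable def radialPolyLaplacian (n k : ℕ) (g : ℝ → ℝ) : ℝ → ℝ :=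
  (fun g => -(radialLaplacian n g))^[k] g

theorem radialPolyLaplacian_succ (k : ℕ) (g : ℝ → ℝ) :
    radialPolyLaplacian n (k + 1) g = -(radialLaplacian n (radialPolyLaplacian n k g)) :=
  Function.iterate_succ_apply' _ _ _

theorem contDiff_deriv (hg : ContDiff ℝ ∞ g) : ContDiff ℝ ∞ (deriv g) :=
  (contDiff_infty_iff_deriv.1 hg).2

theorem contDiff_radial {k : WithTop ℕ∞} (hg : ContDiff ℝ k g) : ContDiff ℝ k (radial n g) :=
  hg.comp (contDiff_norm_sq ℝ)

theorem contDiff_radialPolyLaplacian (hg : ContDiff ℝ ∞ g) (k : ℕ) :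
    ContDiff ℝ ∞ (radialPolyLaplacian n k g) := by
  induction k with
  | zero => exact hg
  | succ k ih =>
    rw [radialPolyLaplacian_succ]
    exact (((contDiff_const.mul contDiff_id).mul (contDiff_deriv (contDiff_deriv ih))).add
      (contDiff_const.mul (contDiff_deriv ih))).neg

theorem partialDeriv_radial (hg : Differentiable ℝ g) (i : Fin n) (z : EuclideanSpace ℝ (Fin n)) :
    partialDeriv i (radial n g) z = 2 * z i * radial n (deriv g) z := by
  have h : HasFDerivAt (radial n g) (deriv g (‖z‖ ^ 2) • (2 • innerSL ℝ z)) z :=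
    (hg (‖z‖ ^ 2)).hasDerivAt.comp_hasFDerivAt z (hasStrictFDerivAt_norm_sq z).hasFDerivAt
  rw [partialDeriv, h.fderiv, radial]
  simp [EuclideanSpace.inner_single_right]
  ring

theorem hasFDerivAt_coord (i : Fin n) (z : EuclideanSpace ℝ (Fin n)) :
    HasFDerivAt (fun z : EuclideanSpace ℝ (Fin n) => z i) (EuclideanSpace.proj (𝕜 := ℝ) i) z :=
  (EuclideanSpace.proj (𝕜 := ℝ) i : EuclideanSpace ℝ (Fin n) →L[ℝ] ℝ).hasFDerivAt

theorem partialDeriv_two_mul_coord (i : Fin n) (z : EuclideanSpace ℝ (Fin n)) :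
    partialDeriv i (fun z : EuclideanSpace ℝ (Fin n) => 2 * z i) z = 2 := by
  rw [partialDeriv, ((hasFDerivAt_coord i z).const_mul 2).fderiv]
  simp

theorem laplacian_radial (hg : ContDiff ℝ 2 g) :
    Δ (radial n g) = radial n (radialLaplacian n g) := by
  have hg' : ContDiff ℝ 1 (deriv g) := (contDiff_succ_iff_deriv (n := 1).1 hg).2.2
  have h (i : Fin n) (z : EuclideanSpace ℝ (Fin n)) :
      partialDeriv i (partialDeriv i (radial n g)) z =
        4 * radial n (deriv (deriv g)) z * z i ^ 2 + 2 * radial n (deriv g) z := by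
    rw [funext (partialDeriv_radial (hg.differentiable two_ne_zero) i),
      partialDeriv_mul (fun z => ((hasFDerivAt_coord i z).const_mul 2).differentiableAt)
        ((contDiff_radial hg').differentiable one_ne_zero),
      partialDeriv_radial (hg'.differentiable one_ne_zero), partialDeriv_two_mul_coord]
    ring
  ext z
  simp only [laplacian_eq_sum_partialDeriv (contDiff_radial hg), h, Finset.sum_add_distrib,
    ← Finset.mul_sum, Finset.sum_const, Finset.card_univ, Fintype.card_fin, nsmul_eq_mul, radial,
    radialLaplacian]
  rw [EuclideanSpace.real_norm_sq_eq]
  ring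

theorem polyLaplacian_radial (hg : ContDiff ℝ ∞ g) (k : ℕ) :
    polyLaplacian k (radial n g) = radial n (radialPolyLaplacian n k g) := by
  induction k with
  | zero => rfl
  | succ k ih =>
    rw [polyLaplacian_succ', ih,
      laplacian_radial (contDiff_infty.1 (contDiff_radialPolyLaplacian hg k) 2),
      radialPolyLaplacian_succ]
    rfl

theorem eqOn_deriv (hU : IsOpen U) (h : EqOn g₁ g₂ U) : EqOn (deriv g₁) (deriv g₂) U :=
  fun _ hs => (h.eventuallyEq_of_mem (hU.mem_nhds hs)).deriv_eq

theorem eqOn_radialLaplacian (hU : IsOpen U) (h : EqOn g₁ g₂ U) :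
    EqOn (radialLaplacian n g₁) (radialLaplacian n g₂) U := by
  intro s hs
  rw [radialLaplacian, radialLaplacian, eqOn_deriv hU h hs, eqOn_deriv hU (eqOn_deriv hU h) hs]

theorem eqOn_radialPolyLaplacian (hU : IsOpen U) (h : EqOn g₁ g₂ U) (k : ℕ) :
    EqOn (radialPolyLaplacian n k g₁) (radialPolyLaplacian n k g₂) U := by
  induction k with
  | zero => exact h
  | succ k ih =>
    simp only [radialPolyLaplacian_succ]
    exact fun s hs => congrArg Neg.neg (eqOn_radialLaplacian hU ih hs)

theorem contDiffOn_deriv (hU : IsOpen U) (hg : ContDiffOn ℝ ∞ g U) : ContDiffOn ℝ ∞ (deriv g) U :=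
  hg.deriv_of_isOpen hU (by simp)

theorem contDiffOn_radialPolyLaplacian (hU : IsOpen U) (hg : ContDiffOn ℝ ∞ g U) (k : ℕ) :
    ContDiffOn ℝ ∞ (radialPolyLaplacian n k g) U := by
  induction k with
  | zero => exact hg
  | succ k ih =>
    rw [radialPolyLaplacian_succ]
    exact (((contDiff_const.mul contDiff_id).contDiffOn.mul
      (contDiffOn_deriv hU (contDiffOn_deriv hU ih))).add
        (contDiffOn_const.mul (contDiffOn_deriv hU ih))).neg

theorem radialLaplacian_comp_mul (g : ℝ → ℝ) (a c : ℝ) :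
    radialLaplacian n (fun s => a * g (c * s)) = fun s => a * c * radialLaplacian n g (c * s) := by
  have deriv_scaled (b : ℝ) (h : ℝ → ℝ) :
      deriv (fun s => b * h (c * s)) = fun s => b * c * deriv h (c * s) := by
    ext s
    rw [deriv_const_mul_field, deriv_comp_mul_left, smul_eq_mul, mul_assoc]
  ext s
  simp only [radialLaplacian, deriv_scaled]
  ring

theorem radialPolyLaplacian_comp_mul (g : ℝ → ℝ) (c : ℝ) (k : ℕ) :
    radialPolyLaplacian n k (fun s => g (c * s)) =
      fun s => c ^ k * radialPolyLaplacian n k g (c * s) := by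
  induction k with
  | zero => simp [radialPolyLaplacian]
  | succ k ih =>
    rw [radialPolyLaplacian_succ, ih, radialLaplacian_comp_mul, radialPolyLaplacian_succ]
    ext s
    simp only [Pi.neg_apply]
    ring

theorem radialPolyLaplacian_sub (hU : IsOpen U) (h₁ : ContDiffOn ℝ ∞ g₁ U)
    (h₂ : ContDiffOn ℝ ∞ g₂ U) (k : ℕ) :
    EqOn (radialPolyLaplacian n k (fun s => g₁ s - g₂ s))
      (fun s => radialPolyLaplacian n k g₁ s - radialPolyLaplacian n k g₂ s) U := by
  have hsub {f₁ f₂ : ℝ → ℝ} (hf₁ : ContDiffOn ℝ ∞ f₁ U) (hf₂ : ContDiffOn ℝ ∞ f₂ U) :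
      EqOn (deriv fun s => f₁ s - f₂ s) (fun s => deriv f₁ s - deriv f₂ s) U := fun s hs =>
    deriv_fun_sub ((hf₁.differentiableOn (by simp)).differentiableAt (hU.mem_nhds hs))
      ((hf₂.differentiableOn (by simp)).differentiableAt (hU.mem_nhds hs))
  induction k with
  | zero => exact fun s _ => rfl
  | succ k ih =>
    intro s hs
    have c₁ := contDiffOn_radialPolyLaplacian (n := n) hU h₁ k
    have c₂ := contDiffOn_radialPolyLaplacian (n := n) hU h₂ k
    have d₁ := hsub c₁ c₂
    have d₂ := (eqOn_deriv hU d₁).trans (hsub (contDiffOn_deriv hU c₁) (contDiffOn_deriv hU c₂))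
    simp only [radialPolyLaplacian_succ, Pi.neg_apply]
    rw [eqOn_radialLaplacian hU ih hs]
    simp only [radialLaplacian]
    rw [d₁ hs, d₂ hs]
    ring

theorem deriv_const_mul_inv_pow (c : ℝ) (j : ℕ) :
    deriv (fun s : ℝ => c * (s ^ j)⁻¹) = fun s => -(c * j) * (s ^ (j + 1))⁻¹ := by
  ext s
  have h : deriv (fun s : ℝ => (s ^ j)⁻¹) s = -j * (s ^ (j + 1))⁻¹ := by
    have := deriv_zpow (-(j : ℤ)) s
    rw [show (-(j : ℤ) - 1) = -((j + 1 : ℕ) : ℤ) by push_cast; ring] at this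
    simpa only [zpow_neg, zpow_natCast, Int.cast_neg, Int.cast_natCast] using this
  rw [deriv_const_mul_field, h]
  ring

theorem radialLaplacian_const_mul_inv_pow (c : ℝ) (j : ℕ) {s : ℝ} (hs : s ≠ 0) :
    radialLaplacian n (fun s => c * (s ^ j)⁻¹) s =
      c * (2 * j * (2 * (j + 1) - n)) * (s ^ (j + 1))⁻¹ := by
  rw [radialLaplacian, deriv_const_mul_inv_pow, deriv_const_mul_inv_pow]
  push_cast
  field_simp
  ring

/-- The coefficient of `‖z‖ ^ (-2 (k + 1))` in `(-Δ)ᵏ⁺¹ (-log ‖z‖)` on `ℝⁿ`. -/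
noncomputable def radialLogCoeff (n k : ℕ) : ℝ :=
  ((n : ℝ) - 2) * ∏ j ∈ Finset.range k, (2 * ((j : ℝ) + 1) * ((n : ℝ) - 4 - 2 * j))

theorem radialPolyLaplacian_log (n k : ℕ) :
    EqOn (radialPolyLaplacian n (k + 1) fun s => -(1 / 2) * Real.log s)
      (fun s => radialLogCoeff n k * (s ^ (k + 1))⁻¹) (Ioi 0) := by
  induction k with
  | zero =>
    have h : deriv (fun s => -(1 / 2) * Real.log s) = fun s => -(1 / 2) * (s ^ 1)⁻¹ := by
      ext s
      rw [deriv_const_mul_field, Real.deriv_log, pow_one]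
    intro s (hs : 0 < s)
    change -(radialLaplacian n (fun s => -(1 / 2) * Real.log s) s) = _
    rw [radialLaplacian, h, deriv_const_mul_inv_pow]
    simp only [radialLogCoeff, Finset.prod_range_zero]
    push_cast
    field_simp
    ring
  | succ k ih =>
    intro s (hs : 0 < s)
    rw [radialPolyLaplacian_succ, Pi.neg_apply, eqOn_radialLaplacian isOpen_Ioi ih hs,
      radialLaplacian_const_mul_inv_pow _ _ hs.ne']
    simp only [radialLogCoeff, Finset.prod_range_succ]
    push_cast
    ring

/-- In even dimension `2m` the logarithm is a fundamental solution of `(-Δ)ᵐ`. -/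
theorem radialLogCoeff_eq_zero (m : ℕ) : radialLogCoeff (2 * (m + 1)) m = 0 := by
  cases m with
  | zero => simp [radialLogCoeff]
  | succ m =>
    refine mul_eq_zero_of_right _ (Finset.prod_eq_zero (Finset.self_mem_range_succ m) ?_)
    push_cast
    ring

end Radial

section Kernel

variable {p q s : ℝ} {n m : ℕ}

/-- A smooth cutoff on the line, `1` for `s ≤ 1` and `0` for `2 ≤ s`. -/
noncomputable def cutoff (s : ℝ) : ℝ := Real.smoothTransition (2 - s)

theorem contDiff_cutoff : ContDiff ℝ ∞ cutoff :=
  Real.smoothTransition.contDiff.comp (contDiff_const.sub contDiff_id)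

theorem cutoff_eq_one (hs : s ≤ 1) : cutoff s = 1 :=
  Real.smoothTransition.one_of_one_le (by linarith)

theorem cutoff_eq_zero (hs : 2 ≤ s) : cutoff s = 0 :=
  Real.smoothTransition.zero_of_nonpos (by linarith)

/-- The kernel `-log ‖z‖`, in the variable `s = ‖z‖²`, cut off to the ball `s ≤ 2`. -/
noncomputable def truncLog (s : ℝ) : ℝ := -(1 / 2) * Real.log s * cutoff s

theorem contDiffOn_truncLog : ContDiffOn ℝ ∞ truncLog (Ioi 0) :=
  (contDiffOn_const.mul (Real.contDiffOn_log.mono fun _ hs => ne_of_gt hs)).mul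
    contDiff_cutoff.contDiffOn

theorem eqOn_truncLog_log : EqOn truncLog (fun s => -(1 / 2) * Real.log s) (Ioo 0 1) := by
  intro s hs
  rw [truncLog, cutoff_eq_one hs.2.le, mul_one]

theorem eqOn_truncLog_zero : EqOn truncLog 0 (Ioi 2) := by
  intro s hs
  rw [truncLog, cutoff_eq_zero (le_of_lt hs), mul_zero, Pi.zero_apply]

/-- The test function `truncLog (q s) - truncLog (p s)`, which approximates the kernel at scales
between `p ^ (-1/2)` and `q ^ (-1/2)`. The two singularities at the origin cancel; the formula is
arranged so that the remaining logarithm multiplies a function vanishing near the origin. -/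
noncomputable def truncLogDiff (p q s : ℝ) : ℝ :=
  1 / 2 * Real.log (p / q) * cutoff (p * s) -
    1 / 2 * Real.log (q * s) * (cutoff (q * s) - cutoff (p * s))

theorem truncLogDiff_eq (hq : 0 < q) (hp : 0 < p) (hs : 0 < s) :
    truncLogDiff p q s = truncLog (q * s) - truncLog (p * s) := by
  unfold truncLogDiff truncLog
  rw [Real.log_div hp.ne' hq.ne', Real.log_mul hq.ne' hs.ne', Real.log_mul hp.ne' hs.ne']
  ring

theorem contDiff_truncLogDiff (hq : 0 < q) (hqp : q ≤ p) : ContDiff ℝ ∞ (truncLogDiff p q) := by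
  have hp : 0 < p := hq.trans_le hqp
  have contDiff_cutoff_mul (r : ℝ) : ContDiff ℝ ∞ (fun s => cutoff (r * s)) :=
    contDiff_cutoff.comp (contDiff_const.mul contDiff_id)
  rw [contDiff_iff_contDiffAt]
  intro s
  rcases lt_or_ge 0 s with hs | hs
  · have contDiffAt_log : ContDiffAt ℝ ∞ (fun s => Real.log (q * s)) s :=
      (Real.contDiffAt_log.2 (mul_pos hq hs).ne').comp s (contDiff_const.mul contDiff_id).contDiffAt
    exact (contDiff_const.mul (contDiff_cutoff_mul p)).contDiffAt.sub
      ((contDiffAt_const.mul contDiffAt_log).mul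
        ((contDiff_cutoff_mul q).sub (contDiff_cutoff_mul p)).contDiffAt)
  · have eventuallyEq : truncLogDiff p q =ᶠ[𝓝 s]
        fun s => 1 / 2 * Real.log (p / q) * cutoff (p * s) := by
      filter_upwards [Iio_mem_nhds (hs.trans_lt (one_div_pos.2 hp))] with t ht
      have hpt : p * t ≤ 1 := by linarith [(lt_div_iff₀ hp).1 ht]
      have hqt : q * t ≤ 1 := by rcases le_or_gt t 0 with h | h <;> nlinarith
      rw [truncLogDiff, cutoff_eq_one hpt, cutoff_eq_one hqt, sub_self, mul_zero, sub_zero]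
    exact (contDiff_const.mul (contDiff_cutoff_mul p)).contDiffAt.congr_of_eventuallyEq eventuallyEq

theorem truncLogDiff_eq_zero (hq : 0 < q) (hqp : q ≤ p) (hs : 2 / q ≤ s) :
    truncLogDiff p q s = 0 := by
  have hqs : 2 ≤ q * s := (div_le_iff₀' hq).1 hs
  have hps : 2 ≤ p * s := hqs.trans
    (mul_le_mul_of_nonneg_right hqp ((by positivity : 0 ≤ 2 / q).trans hs))
  rw [truncLogDiff, cutoff_eq_zero hqs, cutoff_eq_zero hps]
  ring

theorem hasCompactSupport_radial_truncLogDiff (n : ℕ) (hq : 0 < q) (hqp : q ≤ p) :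
    HasCompactSupport (radial n (truncLogDiff p q)) := by
  refine HasCompactSupport.intro (isCompact_closedBall 0 (2 / q + 1)) fun z hz => ?_
  refine truncLogDiff_eq_zero hq hqp ?_
  simp only [Metric.mem_closedBall, dist_zero_right, not_le] at hz
  have : 0 < 2 / q := by positivity
  nlinarith

theorem exists_abs_le_of_eqOn_const {h : ℝ → ℝ} {c : ℝ} (hh : ContinuousOn h (Ioi 0))
    (hc : EqOn h (fun _ => c) (Ioo 0 1)) (h_zero : EqOn h 0 (Ioi 2)) :
    ∃ C, 0 ≤ C ∧ ∀ s, 0 < s → |h s| ≤ C := by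
  obtain ⟨C, hC⟩ := (isCompact_Icc (a := (1 : ℝ)) (b := 2)).exists_bound_of_continuousOn
    (hh.mono fun s hs => lt_of_lt_of_le one_pos hs.1)
  refine ⟨max C |c|, le_max_of_le_right (abs_nonneg _), fun s hs => ?_⟩
  rcases lt_or_ge s 1 with hs₁ | hs₁
  · rw [hc ⟨hs, hs₁⟩]
    exact le_max_right _ _
  rcases lt_or_ge 2 s with hs₂ | hs₂
  · rw [h_zero hs₂, Pi.zero_apply, abs_zero]
    exact le_max_of_le_right (abs_nonneg _)
  · exact le_max_of_le_left (hC s ⟨hs₁, hs₂⟩)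

/-- Minus the radial derivative `r ∂ᵣ` of the truncated logarithm, in the variable `s = r²`. -/
noncomputable def truncLogSlope (s : ℝ) : ℝ := -2 * s * deriv truncLog s

theorem continuousOn_truncLogSlope : ContinuousOn truncLogSlope (Ioi 0) :=
  (continuousOn_const.mul continuousOn_id).mul
    (contDiffOn_deriv isOpen_Ioi contDiffOn_truncLog).continuousOn

theorem truncLogSlope_eq_one (hs₀ : 0 < s) (hs₁ : s < 1) : truncLogSlope s = 1 := by
  rw [truncLogSlope, eqOn_deriv isOpen_Ioo eqOn_truncLog_log ⟨hs₀, hs₁⟩, deriv_const_mul_field,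
    Real.deriv_log]
  field_simp

theorem truncLogSlope_eq_zero (hs : 2 < s) : truncLogSlope s = 0 := by
  rw [truncLogSlope, eqOn_deriv isOpen_Ioi eqOn_truncLog_zero hs, deriv_zero, Pi.zero_apply,
    mul_zero]

theorem exists_abs_truncLogSlope_le : ∃ C, 0 ≤ C ∧ ∀ s, 0 < s → |truncLogSlope s| ≤ C :=
  exists_abs_le_of_eqOn_const continuousOn_truncLogSlope
    (fun _ hs => truncLogSlope_eq_one hs.1 hs.2) fun _ hs => truncLogSlope_eq_zero hs

theorem deriv_truncLogDiff (hq : 0 < q) (hp : 0 < p) (hs : 0 < s) :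
    2 * s * deriv (truncLogDiff p q) s = -(truncLogSlope (q * s) - truncLogSlope (p * s)) := by
  have differentiableAt_comp_mul (r : ℝ) (hr : 0 < r) :
      DifferentiableAt ℝ (fun s => truncLog (r * s)) s :=
    ((contDiffOn_truncLog.differentiableOn (by simp)).differentiableAt
      (isOpen_Ioi.mem_nhds (mul_pos hr hs))).comp s (differentiableAt_id.const_mul r)
  rw [eqOn_deriv isOpen_Ioi (fun t ht => truncLogDiff_eq hq hp ht) hs,
    deriv_fun_sub (differentiableAt_comp_mul q hq) (differentiableAt_comp_mul p hp),
    deriv_comp_mul_left, deriv_comp_mul_left]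
  simp only [truncLogSlope, smul_eq_mul]
  ring

/-- The function `(-Δ)ᵐ` of the truncated logarithm on `ℝ²ᵐ`, in the variable `s = ‖z‖²`. It
vanishes near the origin: the Dirac mass of `(-Δ)ᵐ (-log ‖z‖)` is not part of it. -/
noncomputable def truncLogPolyLaplacian (m : ℕ) : ℝ → ℝ := radialPolyLaplacian (2 * m) m truncLog

theorem continuousOn_truncLogPolyLaplacian : ContinuousOn (truncLogPolyLaplacian m) (Ioi 0) :=
  (contDiffOn_radialPolyLaplacian isOpen_Ioi contDiffOn_truncLog m).continuousOn

theorem radialPolyLaplacian_zero (k : ℕ) : radialPolyLaplacian n k 0 = 0 := by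
  induction k with
  | zero => rfl
  | succ k ih =>
    rw [radialPolyLaplacian_succ, ih]
    ext s
    simp [radialLaplacian]

theorem eqOn_radialPolyLaplacian_truncLog_zero (k : ℕ) :
    EqOn (radialPolyLaplacian n k truncLog) 0 (Ioi 2) :=
  radialPolyLaplacian_zero (n := n) k ▸ eqOn_radialPolyLaplacian isOpen_Ioi eqOn_truncLog_zero k

theorem truncLogPolyLaplacian_eq_zero_of_lt_one (hm : m ≠ 0) (hs₀ : 0 < s) (hs₁ : s < 1) :
    truncLogPolyLaplacian m s = 0 := by
  obtain ⟨k, rfl⟩ := Nat.exists_eq_succ_of_ne_zero hm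
  rw [truncLogPolyLaplacian, eqOn_radialPolyLaplacian isOpen_Ioo eqOn_truncLog_log _ ⟨hs₀, hs₁⟩,
    radialPolyLaplacian_log _ _ hs₀]
  exact mul_eq_zero_of_left (radialLogCoeff_eq_zero k) _

theorem truncLogPolyLaplacian_eq_zero_of_two_lt (hs : 2 < s) : truncLogPolyLaplacian m s = 0 :=
  eqOn_radialPolyLaplacian_truncLog_zero m hs

theorem exists_abs_truncLogPolyLaplacian_le (hm : m ≠ 0) :
    ∃ C, 0 ≤ C ∧ ∀ s, 0 < s → |truncLogPolyLaplacian m s| ≤ C :=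
  exists_abs_le_of_eqOn_const continuousOn_truncLogPolyLaplacian
    (fun _ hs => truncLogPolyLaplacian_eq_zero_of_lt_one hm hs.1 hs.2)
    fun _ hs => truncLogPolyLaplacian_eq_zero_of_two_lt hs

theorem radialPolyLaplacian_truncLogDiff (hq : 0 < q) (hp : 0 < p) (k : ℕ) (hs : 0 < s) :
    radialPolyLaplacian n k (truncLogDiff p q) s =
      q ^ k * radialPolyLaplacian n k truncLog (q * s) -
        p ^ k * radialPolyLaplacian n k truncLog (p * s) := by
  have contDiffOn_comp_mul (r : ℝ) (hr : 0 < r) :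
      ContDiffOn ℝ ∞ (fun s => truncLog (r * s)) (Ioi 0) :=
    contDiffOn_truncLog.comp (contDiff_const.mul contDiff_id).contDiffOn fun _ hs => mul_pos hr hs
  rw [eqOn_radialPolyLaplacian isOpen_Ioi (fun t ht => truncLogDiff_eq hq hp ht) k hs,
    radialPolyLaplacian_sub isOpen_Ioi (contDiffOn_comp_mul q hq) (contDiffOn_comp_mul p hp) k hs]
  simp only [radialPolyLaplacian_comp_mul]

theorem radialLogCoeff_two_mul (k : ℕ) :
    radialLogCoeff (2 * (k + 2)) k = 2 * (k + 1) * 4 ^ k * (k.factorial : ℝ) ^ 2 := by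
  have prod_ascending : ∏ j ∈ Finset.range k, ((j : ℝ) + 1) = k.factorial := by
    exact_mod_cast Finset.prod_range_add_one_eq_factorial k
  have prod_descending : ∏ j ∈ Finset.range k, ((k : ℝ) - j) = k.factorial := by
    rw [← Nat.descFactorial_self, Nat.descFactorial_eq_prod_range, Nat.cast_prod]
    exact Finset.prod_congr rfl fun j hj => (Nat.cast_sub (Finset.mem_range.1 hj).le).symm
  have factor (j : ℕ) : 2 * ((j : ℝ) + 1) * (((2 * (k + 2) : ℕ) : ℝ) - 4 - 2 * j) =
      4 * (((j : ℝ) + 1) * ((k : ℝ) - j)) := by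
    push_cast
    ring
  simp only [radialLogCoeff, factor, Finset.prod_mul_distrib, prod_ascending, prod_descending,
    Finset.prod_const, Finset.card_range]
  push_cast
  ring

theorem deriv_radialPolyLaplacian_log (k : ℕ) (hs : 0 < s) :
    deriv (radialPolyLaplacian (2 * (k + 1)) k fun s => -(1 / 2) * Real.log s) s =
      -(4 ^ k * (k.factorial : ℝ) ^ 2 / 2) * (s ^ (k + 1))⁻¹ := by
  cases k with
  | zero =>
    change deriv (fun s => -(1 / 2) * Real.log s) s = _
    rw [deriv_const_mul_field, Real.deriv_log]
    simp
  | succ k =>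
    rw [eqOn_deriv isOpen_Ioi (radialPolyLaplacian_log _ k) hs, deriv_const_mul_inv_pow,
      radialLogCoeff_two_mul, Nat.factorial_succ]
    push_cast
    ring

theorem hasDerivAt_pow_mul_deriv_sq {h : ℝ → ℝ} {r : ℝ}
    (hh : DifferentiableAt ℝ (deriv h) (r ^ 2)) :
    HasDerivAt (fun r => 2 * r ^ (n + 1) * deriv h (r ^ 2))
      (r ^ n * radialLaplacian (n + 1) h (r ^ 2)) r := by
  have hasDerivAt_deriv_sq : HasDerivAt (fun r => deriv h (r ^ 2)) _ r :=
    hh.hasDerivAt.comp (h := fun r => r ^ 2) r (hasDerivAt_pow 2 r)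
  refine (((hasDerivAt_pow (n + 1) r).const_mul 2).mul hasDerivAt_deriv_sq).congr_deriv ?_
  rw [radialLaplacian]
  simp only [Nat.add_sub_cancel]
  push_cast
  ring

theorem integral_Ioi_pow_mul_radialLaplacian {h : ℝ → ℝ} (hh : ContDiffOn ℝ ∞ h (Ioi 0))
    (h_harmonic : EqOn (radialLaplacian (n + 1) h) 0 (Ioo 0 1)) (h_zero : EqOn h 0 (Ioi 2)) :
    ∫ r in Ioi (0 : ℝ), r ^ n * radialLaplacian (n + 1) h (r ^ 2) =
      -(2 * (1 / 2) ^ (n + 1) * deriv h ((1 / 2) ^ 2)) := by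
  have hh' := contDiffOn_deriv isOpen_Ioi hh
  have deriv_zero_far : EqOn (deriv h) 0 (Ioi 2) := fun s hs => by
    rw [eqOn_deriv isOpen_Ioi h_zero hs, deriv_zero]
  have integrand_zero (r : ℝ) (hr : r ∈ Ioi 0 \ Ioc (1 / 2) 2) :
      r ^ n * radialLaplacian (n + 1) h (r ^ 2) = 0 := by
    obtain ⟨hr₀ : 0 < r, hr⟩ := hr
    rcases le_or_gt r (1 / 2) with hr₁ | hr₁
    · rw [h_harmonic ⟨by positivity, by nlinarith⟩, Pi.zero_apply, mul_zero]
    · have hr₂ : (2 : ℝ) < r ^ 2 := by nlinarith [not_le.1 fun hle => hr ⟨hr₁, hle⟩]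
      rw [radialLaplacian, eqOn_deriv isOpen_Ioi deriv_zero_far hr₂, deriv_zero_far hr₂]
      simp
  have sq_pos {r : ℝ} (hr : r ∈ uIcc (1 / 2 : ℝ) 2) : r ^ 2 ∈ Ioi (0 : ℝ) := by
    rw [uIcc_of_le (by norm_num)] at hr
    exact pow_pos (lt_of_lt_of_le (by norm_num) hr.1) 2
  have hasDerivAt (r : ℝ) (hr : r ∈ uIcc (1 / 2 : ℝ) 2) :
      HasDerivAt (fun r => 2 * r ^ (n + 1) * deriv h (r ^ 2)) _ r :=
    hasDerivAt_pow_mul_deriv_sq ((hh'.differentiableOn (by simp)).differentiableAt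
      (isOpen_Ioi.mem_nhds (sq_pos hr)))
  have continuousOn_radialLaplacian : ContinuousOn (radialLaplacian (n + 1) h) (Ioi 0) :=
    ((continuousOn_const.mul continuousOn_id).mul
      (contDiffOn_deriv isOpen_Ioi hh').continuousOn).add (continuousOn_const.mul hh'.continuousOn)
  rw [setIntegral_eq_of_subset_of_forall_sdiff_eq_zero measurableSet_Ioi
      (fun r (hr : r ∈ Ioc (1 / 2 : ℝ) 2) => lt_trans (by norm_num) hr.1) integrand_zero,
    ← intervalIntegral.integral_of_le (by norm_num),
    intervalIntegral.integral_eq_sub_of_hasDerivAt hasDerivAt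
      ((continuousOn_pow n).mul (continuousOn_radialLaplacian.comp (continuousOn_pow 2)
        fun r hr => sq_pos hr)).intervalIntegrable,
    deriv_zero_far (by norm_num : (2 : ℝ) < 2 ^ 2), Pi.zero_apply, mul_zero, zero_sub]

theorem integral_Ioi_pow_mul_truncLogPolyLaplacian (k : ℕ) :
    ∫ r in Ioi (0 : ℝ), r ^ (2 * (k + 1) - 1) * truncLogPolyLaplacian (k + 1) (r ^ 2) =
      -(4 ^ k * (k.factorial : ℝ) ^ 2) := by
  have truncLogPolyLaplacian_eq : truncLogPolyLaplacian (k + 1) =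
      -(radialLaplacian (2 * k + 1 + 1) (radialPolyLaplacian (2 * (k + 1)) k truncLog)) :=
    radialPolyLaplacian_succ k truncLog
  have h_harmonic : EqOn
      (radialLaplacian (2 * k + 1 + 1) (radialPolyLaplacian (2 * (k + 1)) k truncLog)) 0
      (Ioo 0 1) := fun s hs => by
    have := truncLogPolyLaplacian_eq_zero_of_lt_one k.succ_ne_zero hs.1 hs.2
    rwa [truncLogPolyLaplacian_eq, Pi.neg_apply, neg_eq_zero] at this
  have hquarter : ((1 : ℝ) / 2) ^ 2 ∈ Ioo (0 : ℝ) 1 := by constructor <;> norm_num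
  have pow_two_mul : ((1 : ℝ) / 2) ^ (2 * k + 1 + 1) = ((1 / 2) ^ 2) ^ (k + 1) := by
    rw [← pow_mul]
    rfl
  simp only [truncLogPolyLaplacian_eq, Pi.neg_apply, mul_neg, integral_neg]
  rw [show 2 * (k + 1) - 1 = 2 * k + 1 by omega, integral_Ioi_pow_mul_radialLaplacian
      (contDiffOn_radialPolyLaplacian isOpen_Ioi contDiffOn_truncLog k) h_harmonic
      (eqOn_radialPolyLaplacian_truncLog_zero k),
    eqOn_deriv isOpen_Ioo (eqOn_radialPolyLaplacian isOpen_Ioo eqOn_truncLog_log k) hquarter,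
    deriv_radialPolyLaplacian_log k hquarter.1, pow_two_mul]
  field_simp

/-- `(n - 1)! |𝕊ⁿ| / 2`, the total mass of `(-Δ)^{n/2} (-log ‖z‖)` on `ℝⁿ`. -/
noncomputable def logMass (n : ℕ) : ℝ := ((n - 1).factorial : ℝ) * sphereVolume n / 2

theorem factorial_two_mul_add_one (k : ℕ) :
    (2 * k + 1).factorial = (2 * k + 1).doubleFactorial * (2 ^ k * k.factorial) := by
  rw [Nat.factorial_eq_mul_doubleFactorial, Nat.doubleFactorial_two_mul]

theorem logMass_eq (k : ℕ) : logMass (2 * (k + 1)) =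
    (2 * (k + 1)) * (volume : Measure (EuclideanSpace ℝ (Fin (2 * (k + 1))))).real
      (Metric.ball 0 1) * (4 ^ k * (k.factorial : ℝ) ^ 2) := by
  have volume_odd := InnerProductSpace.volume_ball_of_dim_odd (k := k + 1)
    (E := EuclideanSpace ℝ (Fin (2 * (k + 1) + 1))) (by simp) 0 1
  have volume_even := InnerProductSpace.volume_ball_of_dim_even (k := k + 1)
    (E := EuclideanSpace ℝ (Fin (2 * (k + 1)))) (by simp) 0 1
  rw [finrank_euclideanSpace_fin] at volume_odd volume_even
  simp only [ENNReal.ofReal_one, one_pow, one_mul] at volume_odd volume_even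
  rw [logMass, sphereVolume, Measure.toSphere_real_apply_univ, finrank_euclideanSpace_fin,
    measureReal_def, measureReal_def, volume_odd, volume_even,
    ENNReal.toReal_ofReal (by positivity), ENNReal.toReal_ofReal (by positivity),
    show 2 * (k + 1) - 1 = 2 * k + 1 by omega, factorial_two_mul_add_one,
    show 2 * (k + 1) + 1 = 2 * k + 1 + 2 by ring, Nat.doubleFactorial_add_two, Nat.factorial_succ,
    show (4 : ℝ) ^ k = 2 ^ k * 2 ^ k by rw [← mul_pow]; norm_num]
  have : ((2 * k + 1).doubleFactorial : ℝ) ≠ 0 := by positivity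
  push_cast
  field_simp
  ring

theorem integral_truncLogPolyLaplacian (hm : m ≠ 0) :
    ∫ z : EuclideanSpace ℝ (Fin (2 * m)), truncLogPolyLaplacian m (‖z‖ ^ 2) =
      -logMass (2 * m) := by
  obtain ⟨k, rfl⟩ := Nat.exists_eq_succ_of_ne_zero hm
  rw [integral_fun_norm_addHaar volume fun r => truncLogPolyLaplacian (k + 1) (r ^ 2),
    finrank_euclideanSpace_fin]
  simp only [smul_eq_mul, nsmul_eq_mul, Nat.succ_eq_add_one]
  rw [integral_Ioi_pow_mul_truncLogPolyLaplacian, logMass_eq]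
  push_cast
  ring

end Kernel

section Caccioppoli

variable {n m : ℕ} {u w φ : EuclideanSpace ℝ (Fin n) → ℝ} {a r R : ℝ}

theorem partialDeriv_sq (hφ : Differentiable ℝ φ) (i : Fin n) (z : EuclideanSpace ℝ (Fin n)) :
    partialDeriv i (fun z => φ z ^ 2) z = 2 * φ z * partialDeriv i φ z := by
  simp only [sq]
  rw [partialDeriv_mul hφ hφ]
  ring

theorem hasCompactSupport_gradSq (hφ : HasCompactSupport φ) : HasCompactSupport (gradSq φ) := by
  refine hφ.mono' fun z hz => support_fderiv_subset ℝ fun h => hz ?_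
  simp [gradSq, partialDeriv, h]

theorem hasCompactSupport_sq (hφ : HasCompactSupport φ) : HasCompactSupport (fun z => φ z ^ 2) :=
  hφ.comp_left (g := (· ^ 2)) (zero_pow two_ne_zero)

theorem sum_partialDeriv_sq_mul_partialDeriv_le (hφ : Differentiable ℝ φ) (ha : 0 < a)
    (z : EuclideanSpace ℝ (Fin n)) :
    ∑ i, partialDeriv i (fun z => φ z ^ 2) z * partialDeriv i w z ≤
      a / 2 * (φ z ^ 2 * gradSq w z) + 2 / a * gradSq φ z := by
  simp only [gradSq, Finset.mul_sum, ← Finset.sum_add_distrib]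
  refine Finset.sum_le_sum fun i _ => ?_
  rw [partialDeriv_sq hφ, ← sub_nonneg]
  have : a / 2 * (φ z ^ 2 * partialDeriv i w z ^ 2) + 2 / a * partialDeriv i φ z ^ 2 -
      2 * φ z * partialDeriv i φ z * partialDeriv i w z =
      1 / (2 * a) * (a * φ z * partialDeriv i w z - 2 * partialDeriv i φ z) ^ 2 := by
    field_simp
    ring
  rw [this]
  positivity

theorem integral_sq_mul_gradSq_le (hφ : ContDiff ℝ 1 φ) (hφc : HasCompactSupport φ)
    (hw : ContDiff ℝ 2 w) (ha : 0 < a) :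
    a / 2 * ∫ z, φ z ^ 2 * gradSq w z ≤
      2 / a * (∫ z, gradSq φ z) + ∫ z, φ z ^ 2 * (Δ w z + a * gradSq w z) := by
  have hw₁ : ContDiff ℝ 1 w := hw.of_le one_le_two
  have hφ₂ : ContDiff ℝ 1 (fun z => φ z ^ 2) := hφ.pow 2
  have hφ₂c := hasCompactSupport_sq hφc
  have integrable_gradSq : Integrable (gradSq φ) :=
    (continuous_gradSq hφ).integrable_of_hasCompactSupport (hasCompactSupport_gradSq hφc)
  have integrable_sq_mul_gradSq : Integrable (fun z => φ z ^ 2 * gradSq w z) :=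
    (hφ₂.continuous.mul (continuous_gradSq hw₁)).integrable_of_hasCompactSupport hφ₂c.mul_right
  have integrable_sq_mul_laplacian : Integrable (fun z => φ z ^ 2 * Δ w z) :=
    (hφ₂.continuous.mul (continuous_laplacian hw)).integrable_of_hasCompactSupport hφ₂c.mul_right
  have integrable_cross (i : Fin n) :
      Integrable (fun z => partialDeriv i (fun z => φ z ^ 2) z * partialDeriv i w z) :=
    ((continuous_partialDeriv hφ₂ i).mul
      (continuous_partialDeriv hw₁ i)).integrable_of_hasCompactSupport
        (hasCompactSupport_partialDeriv hφ₂c i).mul_right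
  have cross_le : -∫ z, φ z ^ 2 * Δ w z ≤
      a / 2 * (∫ z, φ z ^ 2 * gradSq w z) + 2 / a * ∫ z, gradSq φ z := by
    rw [integral_mul_laplacian hφ₂ hφ₂c hw, neg_neg,
      ← integral_finsetSum _ fun i _ => integrable_cross i, ← integral_const_mul,
      ← integral_const_mul, ← integral_add (integrable_sq_mul_gradSq.const_mul _)
        (integrable_gradSq.const_mul _)]
    exact integral_mono (integrable_finsetSum _ fun i _ => integrable_cross i)
      ((integrable_sq_mul_gradSq.const_mul _).add (integrable_gradSq.const_mul _))
      (sum_partialDeriv_sq_mul_partialDeriv_le (hφ.differentiable one_ne_zero) ha)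
  have expand : ∫ z, φ z ^ 2 * (Δ w z + a * gradSq w z) =
      (∫ z, φ z ^ 2 * Δ w z) + a * ∫ z, φ z ^ 2 * gradSq w z := by
    rw [← integral_const_mul, ← integral_add integrable_sq_mul_laplacian
      (integrable_sq_mul_gradSq.const_mul a)]
    simp only [mul_add, mul_left_comm]
  rw [expand]
  linarith

theorem sq_mul_max_le {c F : ℝ} (hc : c ^ 2 ≤ 1) (hm : m ≠ 0) :
    c ^ 2 * F ≤ c ^ 2 + max F 0 ^ m := by
  have hF : max F 0 ≤ 1 + max F 0 ^ m := by
    rcases le_total (max F 0) 1 with h | h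
    · linarith [pow_nonneg (le_max_right F 0) m]
    · linarith [le_self_pow₀ h hm]
  calc c ^ 2 * F ≤ c ^ 2 * (1 + max F 0 ^ m) := by gcongr; exact (le_max_left _ _).trans hF
    _ = c ^ 2 + c ^ 2 * max F 0 ^ m := by ring
    _ ≤ c ^ 2 + max F 0 ^ m := by
      gcongr
      exact mul_le_of_le_one_left (pow_nonneg (le_max_right F 0) m) hc

theorem integral_sq_mul_gradSq_le_integral_max (hn : 3 ≤ n) (hm : m ≠ 0) (hφ : ContDiff ℝ 1 φ)
    (hφc : HasCompactSupport φ) (hφ_le : ∀ z, φ z ^ 2 ≤ 1) (hw : ContDiff ℝ 2 w)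
    (hF : Integrable (fun z => max (confLaplacian w z) 0 ^ m)) :
    ((n : ℝ) - 2) / 4 * ∫ z, φ z ^ 2 * gradSq w z ≤
      4 / ((n : ℝ) - 2) * (∫ z, gradSq φ z) + (∫ z, φ z ^ 2) +
        ∫ z, max (confLaplacian w z) 0 ^ m := by
  have hn₂ : 0 < (n : ℝ) - 2 := by
    have : (3 : ℝ) ≤ n := by exact_mod_cast hn
    linarith
  have hφ₂c := hasCompactSupport_sq hφc
  have integrable_sq : Integrable (fun z => φ z ^ 2) :=
    (hφ.continuous.pow 2).integrable_of_hasCompactSupport hφ₂c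
  have integrable_sq_mul : Integrable (fun z => φ z ^ 2 * confLaplacian w z) :=
    ((hφ.continuous.pow 2).mul (continuous_confLaplacian hw)).integrable_of_hasCompactSupport
      hφ₂c.mul_right
  calc ((n : ℝ) - 2) / 4 * ∫ z, φ z ^ 2 * gradSq w z
      = ((n : ℝ) - 2) / 2 / 2 * ∫ z, φ z ^ 2 * gradSq w z := by ring
    _ ≤ 2 / (((n : ℝ) - 2) / 2) * (∫ z, gradSq φ z) + ∫ z, φ z ^ 2 * confLaplacian w z :=
      integral_sq_mul_gradSq_le hφ hφc hw (half_pos hn₂)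
    _ ≤ 2 / (((n : ℝ) - 2) / 2) * (∫ z, gradSq φ z) +
        ∫ z, (φ z ^ 2 + max (confLaplacian w z) 0 ^ m) := by
      refine add_le_add_right (integral_mono integrable_sq_mul (integrable_sq.add hF) fun z => ?_) _
      exact sq_mul_max_le (hφ_le z) hm
    _ = _ := by
      rw [integral_add integrable_sq hF]
      field_simp
      ring

theorem exists_setIntegral_gradSq_le (hn : 3 ≤ n) (hm : m ≠ 0) (hr : 0 < r) :
    ∃ C, 0 ≤ C ∧ ∀ w : EuclideanSpace ℝ (Fin n) → ℝ, ContDiff ℝ 2 w →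
      Integrable (fun z => max (confLaplacian w z) 0 ^ m) →
      ∫ z in Metric.ball 0 r, gradSq w z ≤ C * (1 + ∫ z, max (confLaplacian w z) 0 ^ m) := by
  let φ : ContDiffBump (0 : EuclideanSpace ℝ (Fin n)) := ⟨r, r + 1, hr, by linarith⟩
  have hφ : ContDiff ℝ 1 φ := φ.contDiff
  have hn₂ : 0 < (n : ℝ) - 2 := by
    have : (3 : ℝ) ≤ n := by exact_mod_cast hn
    linarith
  set C := 4 / ((n : ℝ) - 2) * (∫ z, gradSq φ z) + ∫ z, φ z ^ 2
  have hC : 0 ≤ C := add_nonneg (mul_nonneg (by positivity) (integral_nonneg fun _ =>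
    gradSq_nonneg _)) (integral_nonneg fun _ => sq_nonneg _)
  refine ⟨4 / ((n : ℝ) - 2) * (C + 1), by positivity, fun w hw hF => ?_⟩
  set I := ∫ z, max (confLaplacian w z) 0 ^ m
  have hI : 0 ≤ I := integral_nonneg fun z => pow_nonneg (le_max_right _ _) m
  have ball_le : ∫ z in Metric.ball 0 r, gradSq w z ≤ ∫ z, φ z ^ 2 * gradSq w z := by
    rw [setIntegral_congr_fun measurableSet_ball fun z hz => by
      rw [← one_mul (gradSq w z), ← one_pow 2,
        ← φ.one_of_mem_closedBall (Metric.ball_subset_closedBall hz)]]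
    exact setIntegral_le_integral
      (((hφ.continuous.pow 2).mul (continuous_gradSq (hw.of_le one_le_two))
        ).integrable_of_hasCompactSupport (hasCompactSupport_sq φ.hasCompactSupport).mul_right)
      (Eventually.of_forall fun z => mul_nonneg (sq_nonneg _) (gradSq_nonneg z))
  have sq_mul_le := integral_sq_mul_gradSq_le_integral_max hn hm hφ φ.hasCompactSupport
    (fun z => pow_le_one₀ φ.nonneg φ.le_one) hw hF
  calc ∫ z in Metric.ball 0 r, gradSq w z
      ≤ 4 / ((n : ℝ) - 2) * (((n : ℝ) - 2) / 4 * ∫ z, φ z ^ 2 * gradSq w z) :=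
        ball_le.trans_eq (by field_simp)
    _ ≤ 4 / ((n : ℝ) - 2) * ((C + 1) * (1 + I)) :=
      mul_le_mul_of_nonneg_left (by nlinarith [mul_nonneg hC hI]) (by positivity)
    _ = 4 / ((n : ℝ) - 2) * (C + 1) * (1 + I) := by ring

theorem integral_pow_mul_comp_affine (g : EuclideanSpace ℝ (Fin n) → ℝ)
    (x : EuclideanSpace ℝ (Fin n)) (hR : 0 < R) :
    ∫ z, R ^ n * g (x + R • z) = ∫ z, g z := by
  rw [integral_const_mul, Measure.integral_comp_smul volume (fun z => g (x + z)) R,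
    integral_add_left_eq_self g x, finrank_euclideanSpace_fin, smul_eq_mul, ← mul_assoc,
    abs_of_pos (by positivity), mul_inv_cancel₀ (by positivity), one_mul]

theorem integrable_pow_mul_comp_affine {g : EuclideanSpace ℝ (Fin n) → ℝ} (hg : Integrable g)
    (x : EuclideanSpace ℝ (Fin n)) (hR : R ≠ 0) :
    Integrable (fun z => R ^ n * g (x + R • z)) :=
  ((hg.comp_add_left x).comp_smul hR).const_mul _

theorem max_confLaplacian_rescale_pow {u : EuclideanSpace ℝ (Fin (2 * m)) → ℝ}
    (hu : ContDiff ℝ 2 u) (x z : EuclideanSpace ℝ (Fin (2 * m))) (R : ℝ) :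
    max (confLaplacian (rescale u x R) z) 0 ^ m =
      R ^ (2 * m) * max (confLaplacian u (x + R • z)) 0 ^ m := by
  rw [confLaplacian_rescale hu, pow_mul, ← mul_pow, mul_max_of_nonneg _ _ (sq_nonneg R), mul_zero]

theorem exists_setIntegral_gradSq_rescale_le {u : EuclideanSpace ℝ (Fin (2 * m)) → ℝ}
    (hu : ContDiff ℝ 2 u) (hm : 2 ≤ m)
    (hF : Integrable (fun z => max (confLaplacian u z) 0 ^ m)) (hr : 0 < r) :
    ∃ C, 0 ≤ C ∧ ∀ x, ∀ R > 0, ∫ z in Metric.ball 0 r, gradSq (rescale u x R) z ≤ C := by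
  obtain ⟨C, hC₀, hC⟩ := exists_setIntegral_gradSq_le (n := 2 * m) (by lia) (m := m) (by lia) hr
  refine ⟨C * (1 + ∫ z, max (confLaplacian u z) 0 ^ m), mul_nonneg hC₀ (add_nonneg zero_le_one
    (integral_nonneg fun z => pow_nonneg (le_max_right _ _) m)), fun x R hR => ?_⟩
  have := hC (rescale u x R) (contDiff_rescale hu x R)
  simp only [max_confLaplacian_rescale_pow hu] at this
  rw [integral_pow_mul_comp_affine (fun z => max (confLaplacian u z) 0 ^ m) x hR] at this
  exact this (integrable_pow_mul_comp_affine hF x hR.ne')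

end Caccioppoli

section Representation

variable {n m : ℕ} {t R : ℝ}

theorem integrableOn_ball_inv_norm_pow {E : Type*} [NormedAddCommGroup E] [NormedSpace ℝ E]
    [FiniteDimensional ℝ E] [MeasurableSpace E] [BorelSpace E] (μ : Measure E)
    [μ.IsAddHaarMeasure] {k : ℕ} (hk : k < Module.finrank ℝ E) (r : ℝ) :
    IntegrableOn (fun z : E => (‖z‖ ^ k)⁻¹) (Metric.ball 0 r) μ := by
  refine integrableOn_ball_of_norm_le_rpow (C := 1) (α := k) (by lia) (by exact_mod_cast hk)
    (Eventually.of_forall fun z => ?_) (measurable_norm.pow_const k).inv.aestronglyMeasurable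
  rw [Real.rpow_neg (norm_nonneg z), Real.rpow_natCast, one_mul,
    Real.norm_of_nonneg (by positivity)]

theorem integrable_mul_inv_norm {E : Type*} [NormedAddCommGroup E] [NormedSpace ℝ E]
    [FiniteDimensional ℝ E] [MeasurableSpace E] [BorelSpace E] {μ : Measure E}
    [μ.IsAddHaarMeasure] (hE : 1 < Module.finrank ℝ E) {f : E → ℝ} (hf : Continuous f)
    (hfi : Integrable f μ) : Integrable (fun z => f z * ‖z‖⁻¹) μ := by
  have hm : AEStronglyMeasurable (fun z => f z * ‖z‖⁻¹) μ :=
    (hf.measurable.mul measurable_norm.inv).aestronglyMeasurable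
  rw [← integrableOn_univ, ← union_compl_self (Metric.ball (0 : E) 1)]
  refine IntegrableOn.union ?_ ?_
  · obtain ⟨C, hC⟩ := (isCompact_closedBall (0 : E) 1).exists_bound_of_continuousOn hf.continuousOn
    refine ((integrableOn_ball_inv_norm_pow μ hE 1).const_mul C).mono' hm.restrict
      ((ae_restrict_iff' measurableSet_ball).2 (Eventually.of_forall fun z hz => ?_))
    rw [norm_mul, norm_inv, norm_norm, pow_one]
    exact mul_le_mul_of_nonneg_right (hC z (Metric.ball_subset_closedBall hz)) (by positivity)
  · refine hfi.norm.integrableOn.mono' hm.restrict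
      ((ae_restrict_iff' measurableSet_ball.compl).2 (Eventually.of_forall fun z hz => ?_))
    rw [norm_mul, norm_inv, norm_norm]
    refine mul_le_of_le_one_right (norm_nonneg _) (inv_le_one_of_one_le₀ ?_)
    simpa using hz

theorem ae_norm_pos (hn : n ≠ 0) : ∀ᵐ z : EuclideanSpace ℝ (Fin n), 0 < ‖z‖ := by
  have : NeZero n := ⟨hn⟩
  filter_upwards [Measure.ae_ne volume (0 : EuclideanSpace ℝ (Fin n))] with z hz
  exact norm_pos_iff.2 hz

/-- The `i`-th component `zᵢ / ‖z‖²` of the gradient of `log ‖z‖`, with value `0` at the origin. -/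
noncomputable def gradLog (i : Fin n) (z : EuclideanSpace ℝ (Fin n)) : ℝ := z i / ‖z‖ ^ 2

theorem abs_gradLog_le (i : Fin n) (z : EuclideanSpace ℝ (Fin n)) : |gradLog i z| ≤ ‖z‖⁻¹ := by
  rcases eq_or_ne z 0 with rfl | hz
  · simp [gradLog]
  · have hz : 0 < ‖z‖ := norm_pos_iff.2 hz
    rw [gradLog, abs_div, abs_of_pos (pow_pos hz 2), div_le_iff₀ (pow_pos hz 2)]
    calc |z i| ≤ ‖z‖ := PiLp.norm_apply_le z i
      _ = ‖z‖⁻¹ * ‖z‖ ^ 2 := by field_simp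

theorem measurable_gradLog (i : Fin n) : Measurable (gradLog i) :=
  (EuclideanSpace.proj (𝕜 := ℝ) i).continuous.measurable.div (measurable_norm.pow_const 2)

theorem partialDeriv_radial_truncLogDiff {p q : ℝ} (hq : 0 < q) (hqp : q ≤ p) (i : Fin n)
    (z : EuclideanSpace ℝ (Fin n)) :
    partialDeriv i (radial n (truncLogDiff p q)) z =
      -(gradLog i z * (truncLogSlope (q * ‖z‖ ^ 2) - truncLogSlope (p * ‖z‖ ^ 2))) := by
  rw [partialDeriv_radial ((contDiff_truncLogDiff hq hqp).differentiable (by simp))]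
  rcases eq_or_ne z 0 with rfl | hz
  · simp [gradLog]
  · have hz : 0 < ‖z‖ := norm_pos_iff.2 hz
    rw [← mul_neg, ← deriv_truncLogDiff hq (hq.trans_le hqp) (pow_pos hz 2), gradLog, radial]
    field_simp

/-- A smooth compactly supported approximation of the kernel `-log ‖z‖` up to an additive
constant, accurate for `t⁻¹ < ‖z‖ < t` as `t → ∞`. -/
noncomputable def logTestFunction (n : ℕ) (t : ℝ) : EuclideanSpace ℝ (Fin n) → ℝ :=
  radial n (truncLogDiff (t ^ 2) (t ^ 2)⁻¹)

theorem inv_sq_le_sq (ht : 1 ≤ t) : (t ^ 2)⁻¹ ≤ t ^ 2 :=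
  (inv_le_one_of_one_le₀ (one_le_pow₀ ht)).trans (one_le_pow₀ ht)

theorem contDiff_logTestFunction (ht : 1 ≤ t) : ContDiff ℝ ∞ (logTestFunction n t) :=
  contDiff_radial (contDiff_truncLogDiff (by positivity) (inv_sq_le_sq ht))

theorem hasCompactSupport_logTestFunction (ht : 1 ≤ t) :
    HasCompactSupport (logTestFunction n t) :=
  hasCompactSupport_radial_truncLogDiff n (by positivity) (inv_sq_le_sq ht)

theorem partialDeriv_logTestFunction (ht : 1 ≤ t) (i : Fin n) (z : EuclideanSpace ℝ (Fin n)) :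
    partialDeriv i (logTestFunction n t) z = -(gradLog i z *
      (truncLogSlope ((t ^ 2)⁻¹ * ‖z‖ ^ 2) - truncLogSlope (t ^ 2 * ‖z‖ ^ 2))) :=
  partialDeriv_radial_truncLogDiff (by positivity) (inv_sq_le_sq ht) i z

theorem partialDeriv_logTestFunction_eventuallyEq (i : Fin n) {z : EuclideanSpace ℝ (Fin n)}
    (hz : 0 < ‖z‖) : ∀ᶠ t in atTop, partialDeriv i (logTestFunction n t) z = -gradLog i z := by
  have tendsto_sq : Tendsto (fun t : ℝ => t ^ 2) atTop atTop := tendsto_pow_atTop two_ne_zero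
  filter_upwards [eventually_ge_atTop 1, tendsto_sq.eventually_gt_atTop (‖z‖ ^ 2),
    tendsto_sq.eventually_gt_atTop (2 / ‖z‖ ^ 2)] with t ht hfar hnear
  rw [partialDeriv_logTestFunction ht, truncLogSlope_eq_one (by positivity),
    truncLogSlope_eq_zero ((div_lt_iff₀ (by positivity)).1 hnear), sub_zero, mul_one]
  rwa [inv_mul_lt_iff₀ (by positivity), mul_one]

theorem exists_abs_partialDeriv_logTestFunction_le : ∃ C, ∀ t : ℝ, 1 ≤ t →
    ∀ (i : Fin n) (z : EuclideanSpace ℝ (Fin n)), 0 < ‖z‖ →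
      |partialDeriv i (logTestFunction n t) z| ≤ C * ‖z‖⁻¹ := by
  obtain ⟨C, hC₀, hC⟩ := exists_abs_truncLogSlope_le
  refine ⟨C + C, fun t ht i z hz => ?_⟩
  rw [partialDeriv_logTestFunction ht, abs_neg, abs_mul, mul_comm]
  refine mul_le_mul ((abs_sub _ _).trans (add_le_add (hC _ ?_) (hC _ ?_)))
    (abs_gradLog_le i z) (abs_nonneg _) (add_nonneg hC₀ hC₀) <;> positivity

theorem tendsto_integral_partialDeriv_logTestFunction (hn : 2 ≤ n)
    {f : EuclideanSpace ℝ (Fin n) → ℝ} (hf : Continuous f) (hfi : Integrable f) (i : Fin n) :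
    Tendsto (fun t : ℝ => ∫ z, partialDeriv i (logTestFunction n t) z * f z) atTop
      (𝓝 (-∫ z, gradLog i z * f z)) := by
  obtain ⟨C, hC⟩ := exists_abs_partialDeriv_logTestFunction_le (n := n)
  have integrable_bound : Integrable (fun z => C * ‖f z * ‖z‖⁻¹‖) :=
    (integrable_mul_inv_norm (by rwa [finrank_euclideanSpace_fin]) hf hfi).norm.const_mul C
  rw [← integral_neg]
  refine tendsto_integral_filter_of_dominated_convergence _ ?_ ?_ integrable_bound ?_
  · filter_upwards [eventually_ge_atTop 1] with t ht
    exact ((continuous_partialDeriv ((contDiff_logTestFunction ht).of_le (by simp)) i).mul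
      hf).aestronglyMeasurable
  · filter_upwards [eventually_ge_atTop 1] with t ht
    filter_upwards [ae_norm_pos (n := n) (by lia)] with z hz
    calc ‖partialDeriv i (logTestFunction n t) z * f z‖
        ≤ C * ‖z‖⁻¹ * ‖f z‖ := by
          rw [norm_mul]
          exact mul_le_mul_of_nonneg_right (hC t ht i z hz) (norm_nonneg _)
      _ = C * ‖f z * ‖z‖⁻¹‖ := by
          rw [norm_mul, norm_inv, norm_norm]
          ring
  · filter_upwards [ae_norm_pos (n := n) (by lia)] with z hz
    refine tendsto_const_nhds.congr' ?_
    filter_upwards [partialDeriv_logTestFunction_eventuallyEq i hz] with t ht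
    rw [ht, neg_mul]

theorem measurable_truncLogPolyLaplacian (hm : m ≠ 0) : Measurable (truncLogPolyLaplacian m) := by
  obtain ⟨k, rfl⟩ := Nat.exists_eq_succ_of_ne_zero hm
  rw [truncLogPolyLaplacian, radialPolyLaplacian_succ]
  exact (((measurable_const.mul measurable_id).mul (measurable_deriv _)).add
    (measurable_const.mul (measurable_deriv _))).neg

theorem exists_abs_truncLogPolyLaplacian_norm_sq_le (hm : m ≠ 0) : ∃ C, 0 ≤ C ∧
    ∀ᵐ z : EuclideanSpace ℝ (Fin (2 * m)), |truncLogPolyLaplacian m (‖z‖ ^ 2)| ≤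
      (Metric.ball 0 2).indicator (fun _ => C) z := by
  obtain ⟨C, hC₀, hC⟩ := exists_abs_truncLogPolyLaplacian_le hm
  refine ⟨C, hC₀, ?_⟩
  filter_upwards [ae_norm_pos (n := 2 * m) (by lia)] with z hz
  by_cases hz₂ : ‖z‖ < 2
  · rw [indicator_of_mem (by simpa using hz₂)]
    exact hC _ (pow_pos hz 2)
  · rw [truncLogPolyLaplacian_eq_zero_of_two_lt (by nlinarith), abs_zero]
    exact indicator_nonneg (fun _ _ => hC₀) z

theorem integrableOn_ball_of_continuous {g : EuclideanSpace ℝ (Fin n) → ℝ} (hg : Continuous g)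
    (r : ℝ) : IntegrableOn g (Metric.ball 0 r) :=
  (hg.continuousOn.integrableOn_compact (isCompact_closedBall 0 r)).mono_set
    Metric.ball_subset_closedBall

theorem exists_abs_integral_truncLogPolyLaplacian_mul_le (hm : m ≠ 0) : ∃ C, 0 ≤ C ∧
    ∀ g : EuclideanSpace ℝ (Fin (2 * m)) → ℝ, Continuous g →
      Integrable (fun z => truncLogPolyLaplacian m (‖z‖ ^ 2) * g z) ∧
      |∫ z, truncLogPolyLaplacian m (‖z‖ ^ 2) * g z| ≤ C * ∫ z in Metric.ball 0 2, |g z| := by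
  obtain ⟨C, hC₀, hC⟩ := exists_abs_truncLogPolyLaplacian_norm_sq_le hm
  refine ⟨C, hC₀, fun g hg => ?_⟩
  have integrable_bound : Integrable ((Metric.ball 0 2).indicator fun z => C * |g z|) :=
    (integrableOn_ball_of_continuous (continuous_const.mul hg.abs) 2).integrable_indicator
      measurableSet_ball
  have le_bound : ∀ᵐ z, ‖truncLogPolyLaplacian m (‖z‖ ^ 2) * g z‖ ≤
      (Metric.ball 0 2).indicator (fun z => C * |g z|) z := by
    filter_upwards [hC] with z hz
    rw [norm_mul, Real.norm_eq_abs, Real.norm_eq_abs, indicator_mul_left]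
    exact mul_le_mul_of_nonneg_right hz (abs_nonneg _)
  refine ⟨integrable_bound.mono' (((measurable_truncLogPolyLaplacian hm).comp
    (measurable_norm.pow_const 2)).mul hg.measurable).aestronglyMeasurable le_bound, ?_⟩
  calc |∫ z, truncLogPolyLaplacian m (‖z‖ ^ 2) * g z|
      ≤ ∫ z, (Metric.ball 0 2).indicator (fun z => C * |g z|) z :=
        norm_integral_le_of_norm_le integrable_bound le_bound
    _ = C * ∫ z in Metric.ball 0 2, |g z| := by
        rw [integral_indicator measurableSet_ball, integral_const_mul]

theorem integrable_truncLogPolyLaplacian_mul (hm : m ≠ 0)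
    {g : EuclideanSpace ℝ (Fin (2 * m)) → ℝ} (hg : Continuous g) :
    Integrable (fun z => truncLogPolyLaplacian m (‖z‖ ^ 2) * g z) :=
  let ⟨_, _, h⟩ := exists_abs_integral_truncLogPolyLaplacian_mul_le hm
  (h g hg).1

theorem truncLogPolyLaplacian_dilation (g : EuclideanSpace ℝ (Fin (2 * m)) → ℝ) (hR : 0 < R)
    (z : EuclideanSpace ℝ (Fin (2 * m))) :
    R⁻¹ ^ (2 * m) * (truncLogPolyLaplacian m (‖0 + R⁻¹ • z‖ ^ 2) * g (R • (0 + R⁻¹ • z))) =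
      ((R ^ 2)⁻¹) ^ m * truncLogPolyLaplacian m ((R ^ 2)⁻¹ * ‖z‖ ^ 2) * g z := by
  rw [zero_add, norm_smul, smul_inv_smul₀ hR.ne', norm_inv, Real.norm_of_nonneg hR.le, mul_pow,
    pow_mul, inv_pow R 2, mul_assoc]

theorem integral_polyLaplacian_logTestFunction_mul (hm : m ≠ 0)
    {g : EuclideanSpace ℝ (Fin (2 * m)) → ℝ} (hg : Continuous g) (ht : 1 ≤ t) :
    ∫ z, polyLaplacian m (logTestFunction (2 * m) t) z * g z =
      (∫ z, truncLogPolyLaplacian m (‖z‖ ^ 2) * g (t • z)) -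
        ∫ z, truncLogPolyLaplacian m (‖z‖ ^ 2) * g (t⁻¹ • z) := by
  have ht₀ : 0 < t := one_pos.trans_le ht
  have integrable_dilation {R : ℝ} (hR : 0 < R) : Integrable fun z =>
      ((R ^ 2)⁻¹) ^ m * truncLogPolyLaplacian m ((R ^ 2)⁻¹ * ‖z‖ ^ 2) * g z := by
    simp only [← truncLogPolyLaplacian_dilation g hR]
    exact integrable_pow_mul_comp_affine (integrable_truncLogPolyLaplacian_mul hm
      (hg.comp (continuous_const_smul R))) 0 (inv_ne_zero hR.ne')
  have integral_dilation {R : ℝ} (hR : 0 < R) :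
      ∫ z, ((R ^ 2)⁻¹) ^ m * truncLogPolyLaplacian m ((R ^ 2)⁻¹ * ‖z‖ ^ 2) * g z =
        ∫ z, truncLogPolyLaplacian m (‖z‖ ^ 2) * g (R • z) := by
    simp only [← truncLogPolyLaplacian_dilation g hR]
    exact integral_pow_mul_comp_affine
      (fun z => truncLogPolyLaplacian m (‖z‖ ^ 2) * g (R • z)) 0 (inv_pos.2 hR)
  rw [← integral_dilation ht₀, ← integral_dilation (inv_pos.2 ht₀),
    ← integral_sub (integrable_dilation ht₀) (integrable_dilation (inv_pos.2 ht₀))]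
  refine integral_congr_ae ?_
  filter_upwards [ae_norm_pos (n := 2 * m) (by lia)] with z hz
  rw [logTestFunction, polyLaplacian_radial (contDiff_truncLogDiff (by positivity)
    (inv_sq_le_sq ht)), radial, radialPolyLaplacian_truncLogDiff (by positivity) (by positivity) _
    (pow_pos hz 2), inv_pow t 2, inv_inv]
  simp only [truncLogPolyLaplacian]
  ring

theorem tendsto_integral_truncLogPolyLaplacian_mul_comp_smul (hm : m ≠ 0)
    {g : EuclideanSpace ℝ (Fin (2 * m)) → ℝ} (hg : Continuous g) :
    Tendsto (fun t : ℝ => ∫ z, truncLogPolyLaplacian m (‖z‖ ^ 2) * g (t⁻¹ • z)) atTop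
      (𝓝 (-logMass (2 * m) * g 0)) := by
  obtain ⟨C, hC⟩ := (isCompact_closedBall (0 : EuclideanSpace ℝ (Fin (2 * m))) 2
    ).exists_bound_of_continuousOn hg.continuousOn
  have integrable_kernel : Integrable (fun z : EuclideanSpace ℝ (Fin (2 * m)) =>
      truncLogPolyLaplacian m (‖z‖ ^ 2)) := by
    simpa using integrable_truncLogPolyLaplacian_mul hm continuous_const (g := fun _ => 1)
  rw [← integral_truncLogPolyLaplacian hm, ← integral_mul_const]
  refine tendsto_integral_filter_of_dominated_convergence
    (fun z => ‖truncLogPolyLaplacian m (‖z‖ ^ 2)‖ * C) (Eventually.of_forall fun t =>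
      (integrable_truncLogPolyLaplacian_mul hm
        (hg.comp (continuous_const_smul _))).aestronglyMeasurable) ?_
    (integrable_kernel.norm.mul_const _) (Eventually.of_forall fun z => ?_)
  · filter_upwards [eventually_ge_atTop 1] with t ht
    refine Eventually.of_forall fun z => ?_
    rw [norm_mul]
    rcases le_or_gt 2 ‖z‖ with hz | hz
    · rw [truncLogPolyLaplacian_eq_zero_of_two_lt (by nlinarith), norm_zero, zero_mul, zero_mul]
    · refine mul_le_mul_of_nonneg_left (hC _ ?_) (norm_nonneg _)
      rw [mem_closedBall_zero_iff, norm_smul, norm_inv, Real.norm_of_nonneg (by positivity)]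
      exact (mul_le_of_le_one_left (norm_nonneg z) (inv_le_one_of_one_le₀ ht)).trans hz.le
  · have tendsto_smul : Tendsto (fun t : ℝ => t⁻¹ • z) atTop (𝓝 0) := by
      simpa using (tendsto_inv_atTop_zero (𝕜 := ℝ)).smul_const z
    exact ((hg.tendsto 0).comp tendsto_smul).const_mul _

theorem abs_partialDeriv_le (w : EuclideanSpace ℝ (Fin n) → ℝ) (i : Fin n)
    (z : EuclideanSpace ℝ (Fin n)) : |partialDeriv i w z| ≤ 1 + gradSq w z := by
  have sq_le : partialDeriv i w z ^ 2 ≤ gradSq w z :=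
    Finset.single_le_sum (f := fun i => partialDeriv i w z ^ 2) (fun _ _ => sq_nonneg _)
      (Finset.mem_univ i)
  nlinarith [sq_nonneg (|partialDeriv i w z| - 1), sq_abs (partialDeriv i w z)]

theorem setIntegral_abs_partialDeriv_le {w : EuclideanSpace ℝ (Fin n) → ℝ} (hw : ContDiff ℝ 1 w)
    (i : Fin n) (r : ℝ) : ∫ z in Metric.ball 0 r, |partialDeriv i w z| ≤
      volume.real (Metric.ball (0 : EuclideanSpace ℝ (Fin n)) r) +
        ∫ z in Metric.ball 0 r, gradSq w z := by
  have integrable_one : IntegrableOn (fun _ : EuclideanSpace ℝ (Fin n) => (1 : ℝ))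
      (Metric.ball 0 r) := integrableOn_ball_of_continuous continuous_const r
  have integrable_gradSq := integrableOn_ball_of_continuous (continuous_gradSq hw) r
  rw [← setIntegral_one_eq_measureReal, ← integral_add integrable_one integrable_gradSq]
  exact integral_mono (integrableOn_ball_of_continuous (continuous_partialDeriv hw i).abs r)
    (integrable_one.add integrable_gradSq) (abs_partialDeriv_le w i)

variable {u : EuclideanSpace ℝ (Fin (2 * m)) → ℝ}

theorem tendsto_integral_truncLogPolyLaplacian_mul_partialDeriv (hu : ContDiff ℝ 2 u) (hm : 2 ≤ m)
    (hF : Integrable (fun z => max (confLaplacian u z) 0 ^ m)) (i : Fin (2 * m)) :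
    Tendsto (fun t : ℝ => ∫ z, truncLogPolyLaplacian m (‖z‖ ^ 2) * partialDeriv i u (t • z)) atTop
      (𝓝 0) := by
  obtain ⟨B, -, hB⟩ := exists_setIntegral_gradSq_rescale_le hu hm hF two_pos
  obtain ⟨C, hC₀, hC⟩ := exists_abs_integral_truncLogPolyLaplacian_mul_le (m := m) (by lia)
  set V := volume.real (Metric.ball (0 : EuclideanSpace ℝ (Fin (2 * m))) 2)
  have norm_le (t : ℝ) (ht : 0 < t) : ‖∫ z, truncLogPolyLaplacian m (‖z‖ ^ 2) *
      partialDeriv i u (t • z)‖ ≤ t⁻¹ * (C * (V + B)) := by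
    have hw : ContDiff ℝ 1 (rescale u 0 t) := contDiff_rescale (hu.of_le one_le_two) 0 t
    have partialDeriv_smul (z : EuclideanSpace ℝ (Fin (2 * m))) :
        partialDeriv i u (t • z) = t⁻¹ * partialDeriv i (rescale u 0 t) z := by
      rw [partialDeriv_rescale, Pi.smul_apply, smul_eq_mul, inv_mul_cancel_left₀ ht.ne', rescale,
        zero_add]
    simp only [partialDeriv_smul, mul_left_comm _ t⁻¹]
    rw [integral_const_mul, norm_mul, norm_inv, Real.norm_of_nonneg ht.le]
    gcongr
    refine (hC _ (continuous_partialDeriv hw i)).2.trans (mul_le_mul_of_nonneg_left ?_ hC₀)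
    exact (setIntegral_abs_partialDeriv_le hw i 2).trans (add_le_add_right (hB 0 t ht) V)
  refine squeeze_zero_norm' ((eventually_gt_atTop 0).mono norm_le) ?_
  simpa using tendsto_inv_atTop_zero.mul_const (C * (V + B))

theorem logMass_mul_partialDeriv_zero (hu : ContDiff ℝ ∞ u) (hm : 2 ≤ m)
    (hF : Integrable (fun z => max (confLaplacian u z) 0 ^ m))
    (hf : Integrable (polyLaplacian m u)) (i : Fin (2 * m)) :
    logMass (2 * m) * partialDeriv i u 0 = ∫ z, gradLog i z * polyLaplacian m u z := by
  have hg : Continuous (partialDeriv i u) := continuous_partialDeriv (contDiff_infty.1 hu 1) i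
  have tendsto_neg_gradLog := tendsto_integral_partialDeriv_logTestFunction (by lia)
    (contDiff_polyLaplacian hu m).continuous hf i
  have tendsto_logMass :=
    ((tendsto_integral_truncLogPolyLaplacian_mul_partialDeriv (contDiff_infty.1 hu 2) hm hF i).sub
      (tendsto_integral_truncLogPolyLaplacian_mul_comp_smul (by lia) hg)).neg
  have by_parts : ∀ᶠ t in atTop, ∫ z, partialDeriv i (logTestFunction (2 * m) t) z *
      polyLaplacian m u z = -((∫ z, truncLogPolyLaplacian m (‖z‖ ^ 2) * partialDeriv i u (t • z)) -
        ∫ z, truncLogPolyLaplacian m (‖z‖ ^ 2) * partialDeriv i u (t⁻¹ • z)) := by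
    filter_upwards [eventually_ge_atTop 1] with t ht
    rw [integral_partialDeriv_mul_polyLaplacian (contDiff_logTestFunction ht)
      (hasCompactSupport_logTestFunction ht) hu,
      integral_polyLaplacian_logTestFunction_mul (by lia) hg ht]
  linarith [tendsto_nhds_unique (tendsto_neg_gradLog.congr' by_parts) tendsto_logMass]

theorem logMass_mul_partialDeriv (hu : ContDiff ℝ ∞ u) (hm : 2 ≤ m)
    (hF : Integrable (fun z => max (confLaplacian u z) 0 ^ m))
    (hf : Integrable (polyLaplacian m u)) (i : Fin (2 * m))
    (x : EuclideanSpace ℝ (Fin (2 * m))) :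
    logMass (2 * m) * partialDeriv i u x = ∫ y, gradLog i (y - x) * polyLaplacian m u y := by
  have hF' : Integrable (fun z => max (confLaplacian (rescale u x 1) z) 0 ^ m) := by
    simp only [max_confLaplacian_rescale_pow (contDiff_infty.1 hu 2)]
    exact integrable_pow_mul_comp_affine hF x one_ne_zero
  have hf' : Integrable (polyLaplacian m (rescale u x 1)) := by
    rw [polyLaplacian_translate hu]
    refine (hf.comp_add_left x).congr (Eventually.of_forall fun z => ?_)
    simp only [rescale, one_smul]
  have representation := logMass_mul_partialDeriv_zero (contDiff_rescale hu x 1) hm hF' hf' i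
  rw [partialDeriv_rescale, polyLaplacian_translate hu] at representation
  simp only [rescale, one_smul, add_zero] at representation
  rw [representation,
    ← integral_add_left_eq_self (fun y => gradLog i (y - x) * polyLaplacian m u y) x]
  simp only [add_sub_cancel_left]

end Representation

section Asymptotics

open scoped ENNReal

variable {n m : ℕ}

theorem exists_setLIntegral_inv_norm_sub_pow_le {E : Type*} [NormedAddCommGroup E]
    [NormedSpace ℝ E] [FiniteDimensional ℝ E] [MeasurableSpace E] [BorelSpace E] (μ : Measure E)
    [μ.IsAddHaarMeasure] {k : ℕ} (hk : k < Module.finrank ℝ E) {s : Set E} (hs : μ s ≠ ⊤) :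
    ∃ C ≠ ⊤, ∀ w : E, ∫⁻ ξ in s, ENNReal.ofReal (‖w - ξ‖ ^ k)⁻¹ ∂μ ≤ C := by
  set g : E → ℝ≥0∞ := (Metric.ball 0 1).indicator fun z => ENNReal.ofReal (‖z‖ ^ k)⁻¹ with hg
  have lintegral_ne_top : ∫⁻ z, g z ∂μ ≠ ⊤ := by
    rw [hg, lintegral_indicator measurableSet_ball]
    exact (integrableOn_ball_inv_norm_pow μ hk 1).lintegral_lt_top.ne
  have le_add_one (z : E) : ENNReal.ofReal (‖z‖ ^ k)⁻¹ ≤ g z + 1 := by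
    by_cases hz : z ∈ Metric.ball (0 : E) 1
    · rw [hg, indicator_of_mem hz]
      exact le_self_add
    · refine le_add_of_le_right (ENNReal.ofReal_le_one.2 (inv_le_one_of_one_le₀ (one_le_pow₀ ?_)))
      simpa using hz
  refine ⟨(∫⁻ z, g z ∂μ) + μ s, ENNReal.add_ne_top.2 ⟨lintegral_ne_top, hs⟩, fun w => ?_⟩
  calc ∫⁻ ξ in s, ENNReal.ofReal (‖w - ξ‖ ^ k)⁻¹ ∂μ
      ≤ ∫⁻ ξ in s, (g (w - ξ) + 1) ∂μ := lintegral_mono fun ξ => le_add_one (w - ξ)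
    _ = (∫⁻ ξ in s, g (w - ξ) ∂μ) + μ s := by
        rw [lintegral_add_right _ measurable_const, setLIntegral_one]
    _ ≤ (∫⁻ ξ, g (w - ξ) ∂μ) + μ s := by
        gcongr
        exact Measure.restrict_le_self
    _ = (∫⁻ z, g z ∂μ) + μ s := by rw [lintegral_sub_left_eq_self g w]

theorem sq_enorm_integral_mul_le {α : Type*} [MeasurableSpace α] {μ : Measure α} {k f : α → ℝ}
    (hk : AEMeasurable k μ) (hf : AEMeasurable f μ) :
    ‖∫ y, k y * f y ∂μ‖ₑ ^ 2 ≤ (∫⁻ y, ‖f y‖ₑ ∂μ) * ∫⁻ y, ‖k y‖ₑ ^ 2 * ‖f y‖ₑ ∂μ := by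
  have sqrt_sq (a : ℝ≥0∞) : (a ^ (1 / 2 : ℝ)) ^ 2 = a := by
    rw [← ENNReal.rpow_natCast, ← ENNReal.rpow_mul]
    norm_num
  have enorm_mul_eq (y : α) : ‖k y * f y‖ₑ =
      ‖f y‖ₑ ^ (1 / 2 : ℝ) * (‖k y‖ₑ ^ 2 * ‖f y‖ₑ) ^ (1 / 2 : ℝ) := by
    rw [← ENNReal.mul_rpow_of_nonneg _ _ (by norm_num), mul_left_comm, ← sq, ← mul_pow,
      ← enorm_mul, ← ENNReal.rpow_natCast, ← ENNReal.rpow_mul]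
    norm_num
  calc ‖∫ y, k y * f y ∂μ‖ₑ ^ 2
      ≤ (∫⁻ y, ‖k y * f y‖ₑ ∂μ) ^ 2 := by
        gcongr
        exact enorm_integral_le_lintegral_enorm _
    _ ≤ ((∫⁻ y, ‖f y‖ₑ ∂μ) ^ (1 / 2 : ℝ) *
          (∫⁻ y, ‖k y‖ₑ ^ 2 * ‖f y‖ₑ ∂μ) ^ (1 / 2 : ℝ)) ^ 2 := by
        simp only [enorm_mul_eq]
        gcongr
        exact ENNReal.lintegral_mul_norm_pow_le hf.enorm ((hk.enorm.pow_const 2).mul hf.enorm)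
          (by norm_num) (by norm_num) (by norm_num)
    _ = _ := by rw [mul_pow, sqrt_sq, sqrt_sq]

theorem mul_gradLog_smul (i : Fin n) {R : ℝ} (hR : 0 < R) (z : EuclideanSpace ℝ (Fin n)) :
    R * gradLog i (R • z) = gradLog i z := by
  rw [gradLog, gradLog, norm_smul, Real.norm_of_nonneg hR.le, PiLp.smul_apply, smul_eq_mul,
    mul_pow, sq R, mul_assoc, ← mul_div_assoc, mul_div_mul_left _ _ hR.ne',
    mul_div_mul_left _ _ hR.ne']

theorem gradLog_eq_inversion (i : Fin n) (z : EuclideanSpace ℝ (Fin n)) :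
    gradLog i z = EuclideanGeometry.inversion 0 1 z i := by
  simp [gradLog, EuclideanGeometry.inversion, div_eq_inv_mul]

/-- The difference `gradLog i (w - ξ) - gradLog i (0 - ξ)` between the kernels with poles `w` and
`0`, written with the sign of the second term absorbed. -/
noncomputable def gradLogDifference (i : Fin n) (w ξ : EuclideanSpace ℝ (Fin n)) : ℝ :=
  gradLog i (w - ξ) + gradLog i ξ

theorem measurable_gradLogDifference {α : Type*} [MeasurableSpace α] (i : Fin n)
    {w ξ : α → EuclideanSpace ℝ (Fin n)} (hw : Measurable w) (hξ : Measurable ξ) :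
    Measurable fun a => gradLogDifference i (w a) (ξ a) :=
  ((measurable_gradLog i).comp (hw.sub hξ)).add ((measurable_gradLog i).comp hξ)

theorem abs_gradLogDifference_le (i : Fin n) {w ξ : EuclideanSpace ℝ (Fin n)} (hξ : ξ ≠ 0)
    (hw : w ≠ ξ) : |gradLogDifference i w ξ| ≤ ‖w‖ * ‖ξ‖⁻¹ * ‖w - ξ‖⁻¹ := by
  have gradLog_neg : gradLog i (-ξ) = -gradLog i ξ := by
    rw [gradLog, gradLog, norm_neg, PiLp.neg_apply, neg_div]
  calc |gradLogDifference i w ξ|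
      = |(EuclideanGeometry.inversion 0 1 (w - ξ) - EuclideanGeometry.inversion 0 1 (-ξ)) i| := by
        rw [PiLp.sub_apply, ← gradLog_eq_inversion, ← gradLog_eq_inversion, gradLog_neg,
          sub_neg_eq_add, gradLogDifference]
    _ ≤ dist (EuclideanGeometry.inversion 0 1 (w - ξ)) (EuclideanGeometry.inversion 0 1 (-ξ)) := by
        rw [dist_eq_norm]
        exact PiLp.norm_apply_le
          (EuclideanGeometry.inversion 0 1 (w - ξ) - EuclideanGeometry.inversion 0 1 (-ξ)) i
    _ = ‖w‖ * ‖ξ‖⁻¹ * ‖w - ξ‖⁻¹ := by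
        rw [EuclideanGeometry.dist_inversion_inversion (sub_ne_zero.2 hw) (neg_ne_zero.2 hξ),
          dist_zero_right, dist_zero_right, norm_neg, dist_eq_norm, sub_neg_eq_add, sub_add_cancel]
        ring

theorem sq_gradLogDifference_le (i : Fin n) (w ξ : EuclideanSpace ℝ (Fin n)) :
    gradLogDifference i w ξ ^ 2 ≤ 2 * ((‖w - ξ‖ ^ 2)⁻¹ + (‖ξ‖ ^ 2)⁻¹) := by
  have sq_gradLog_le (z : EuclideanSpace ℝ (Fin n)) : gradLog i z ^ 2 ≤ (‖z‖ ^ 2)⁻¹ := by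
    rw [← inv_pow, ← sq_abs]
    exact pow_le_pow_left₀ (abs_nonneg _) (abs_gradLog_le i z) 2
  exact add_sq_le.trans (by gcongr <;> exact sq_gradLog_le _)

/-- The closed annulus `1 ≤ ‖ξ‖ ≤ 2`, on which the blow-downs of `u` are compared. -/
def annulus (n : ℕ) : Set (EuclideanSpace ℝ (Fin n)) := {ξ | 1 ≤ ‖ξ‖ ∧ ‖ξ‖ ≤ 2}

theorem isCompact_annulus : IsCompact (annulus n) := by
  refine (isCompact_closedBall (0 : EuclideanSpace ℝ (Fin n)) 2).of_isClosed_subset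
    ((isClosed_le continuous_const continuous_norm).inter
      (isClosed_le continuous_norm continuous_const)) fun ξ hξ => ?_
  simpa using hξ.2

theorem measurableSet_annulus : MeasurableSet (annulus n) :=
  isCompact_annulus.isClosed.measurableSet

theorem ne_zero_of_mem_annulus {ξ : EuclideanSpace ℝ (Fin n)} (hξ : ξ ∈ annulus n) : ξ ≠ 0 :=
  norm_pos_iff.1 (one_pos.trans_le hξ.1)

theorem exists_setLIntegral_sq_gradLogDifference_le (hn : 3 ≤ n) (i : Fin n) :
    ∃ C ≠ ⊤, ∀ w : EuclideanSpace ℝ (Fin n),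
      ∫⁻ ξ in annulus n, ‖gradLogDifference i w ξ‖ₑ ^ 2 ≤ min 1 (ENNReal.ofReal (‖w‖ ^ 2)) * C := by
  have : NeZero n := ⟨by lia⟩
  obtain ⟨C, hC, hCw⟩ := exists_setLIntegral_inv_norm_sub_pow_le (k := 2)
    (volume : Measure (EuclideanSpace ℝ (Fin n))) (by rw [finrank_euclideanSpace_fin]; lia)
    isCompact_annulus.measure_lt_top.ne
  have sq_enorm (a : ℝ) : ‖a‖ₑ ^ 2 = ENNReal.ofReal (a ^ 2) := by
    rw [Real.enorm_eq_ofReal_abs, ← ENNReal.ofReal_pow (abs_nonneg _), sq_abs]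
  have inv_sq_le_one {ξ : EuclideanSpace ℝ (Fin n)} (hξ : ξ ∈ annulus n) : (‖ξ‖ ^ 2)⁻¹ ≤ 1 :=
    inv_le_one_of_one_le₀ (one_le_pow₀ hξ.1)
  have le_uniform (w : EuclideanSpace ℝ (Fin n)) :
      ∫⁻ ξ in annulus n, ‖gradLogDifference i w ξ‖ₑ ^ 2 ≤ 2 * (C + volume (annulus n)) := by
    grw [← hCw w, ← setLIntegral_one, ← lintegral_add_right _ measurable_const,
      ← lintegral_const_mul _ (by fun_prop)]
    refine setLIntegral_mono' measurableSet_annulus fun ξ hξ => ?_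
    rw [sq_enorm, ← ENNReal.ofReal_one, ← ENNReal.ofReal_add (by positivity) one_pos.le]
    grw [sq_gradLogDifference_le, inv_sq_le_one hξ, ENNReal.ofReal_mul zero_le_two,
      ENNReal.ofReal_ofNat]
  have le_near_zero (w : EuclideanSpace ℝ (Fin n)) :
      ∫⁻ ξ in annulus n, ‖gradLogDifference i w ξ‖ₑ ^ 2 ≤ ENNReal.ofReal (‖w‖ ^ 2) * C := by
    grw [← hCw w, ← lintegral_const_mul _ (by fun_prop)]
    refine setLIntegral_mono_ae (by fun_prop) ?_
    filter_upwards [Measure.ae_ne volume w] with ξ hξw hξ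
    rw [sq_enorm, ← ENNReal.ofReal_mul (by positivity), ← sq_abs]
    refine ENNReal.ofReal_le_ofReal ?_
    grw [abs_gradLogDifference_le i (ne_zero_of_mem_annulus hξ) hξw.symm, mul_pow, mul_pow,
      inv_pow, inv_pow, inv_sq_le_one hξ, mul_one]
  refine ⟨2 * (C + volume (annulus n)),
    ENNReal.mul_ne_top (by simp) (ENNReal.add_ne_top.2 ⟨hC, isCompact_annulus.measure_lt_top.ne⟩),
    fun w => ?_⟩
  rw [min_mul_of_nonneg _ _ zero_le, one_mul]
  refine le_min (le_uniform w) ((le_near_zero w).trans (mul_le_mul_right ?_ _))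
  rw [two_mul, add_assoc]
  exact le_self_add

theorem tendsto_lintegral_setLIntegral_sq_gradLogDifference_mul (hn : 3 ≤ n) (i : Fin n)
    {φ : EuclideanSpace ℝ (Fin n) → ℝ≥0∞} (hφ : Measurable φ) (hφi : ∫⁻ y, φ y ≠ ⊤) :
    Tendsto (fun R : ℝ => ∫⁻ y, (∫⁻ ξ in annulus n, ‖gradLogDifference i (R⁻¹ • y) ξ‖ₑ ^ 2) * φ y)
      atTop (𝓝 0) := by
  obtain ⟨C, hC, hCw⟩ := exists_setLIntegral_sq_gradLogDifference_le hn i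
  have measurable_inner : Measurable fun w : EuclideanSpace ℝ (Fin n) =>
      ∫⁻ ξ in annulus n, ‖gradLogDifference i w ξ‖ₑ ^ 2 :=
    ((measurable_gradLogDifference i measurable_fst
      measurable_snd).enorm.pow_const 2).lintegral_prod_right'
  have φ_lt_top : ∀ᵐ y, φ y < ⊤ := ae_lt_top hφ hφi
  rw [← lintegral_zero (μ := (volume : Measure (EuclideanSpace ℝ (Fin n))))]
  refine tendsto_lintegral_filter_of_dominated_convergence (fun y => C * φ y)
    (Eventually.of_forall fun R => (measurable_inner.comp (measurable_const_smul _)).mul hφ)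
    (Eventually.of_forall fun R => Eventually.of_forall fun y => ?_) ?_ ?_
  · gcongr
    exact (hCw _).trans (mul_le_of_le_one_left' (min_le_left _ _))
  · rw [lintegral_const_mul _ hφ]
    exact ENNReal.mul_ne_top hC hφi
  · filter_upwards [φ_lt_top] with y hy
    have tendsto_norm : Tendsto (fun R : ℝ => ‖R⁻¹ • y‖ ^ 2) atTop (𝓝 0) := by
      simpa using ((tendsto_inv_atTop_zero (𝕜 := ℝ)).smul_const y).norm.pow 2
    have tendsto_bound : Tendsto (fun R : ℝ => ENNReal.ofReal (‖R⁻¹ • y‖ ^ 2) * C * φ y) atTop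
        (𝓝 0) := by
      simpa using ENNReal.Tendsto.mul_const (ENNReal.Tendsto.mul_const
        (ENNReal.tendsto_ofReal tendsto_norm) (Or.inr hC)) (Or.inr hy.ne)
    refine tendsto_of_tendsto_of_tendsto_of_le_of_le tendsto_const_nhds tendsto_bound
      (fun _ => zero_le) fun R => ?_
    gcongr
    exact (hCw _).trans (mul_le_mul_left (min_le_right _ _) C)

theorem tendsto_setLIntegral_sq_integral_gradLogDifference_mul (hn : 3 ≤ n) (i : Fin n)
    {f : EuclideanSpace ℝ (Fin n) → ℝ} (hf : Measurable f) (hfi : Integrable f) :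
    Tendsto (fun R : ℝ => ∫⁻ ξ in annulus n, ‖∫ y, gradLogDifference i (R⁻¹ • y) ξ * f y‖ₑ ^ 2)
      atTop (𝓝 0) := by
  have measurable_weighted_kernel (R : ℝ) : Measurable
      fun p : EuclideanSpace ℝ (Fin n) × EuclideanSpace ℝ (Fin n) =>
        ‖gradLogDifference i (R⁻¹ • p.2) p.1‖ₑ ^ 2 * ‖f p.2‖ₑ :=
    ((measurable_gradLogDifference i (by fun_prop) (by fun_prop)).enorm.pow_const 2).mul
      (hf.comp measurable_snd).enorm
  have tendsto_bound := ENNReal.Tendsto.const_mul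
    (tendsto_lintegral_setLIntegral_sq_gradLogDifference_mul hn i hf.enorm hfi.2.ne)
    (Or.inr hfi.2.ne)
  rw [mul_zero] at tendsto_bound
  refine tendsto_of_tendsto_of_tendsto_of_le_of_le tendsto_const_nhds tendsto_bound
    (fun _ => zero_le) fun R => ?_
  calc ∫⁻ ξ in annulus n, ‖∫ y, gradLogDifference i (R⁻¹ • y) ξ * f y‖ₑ ^ 2
      ≤ ∫⁻ ξ in annulus n, (∫⁻ y, ‖f y‖ₑ) *
          ∫⁻ y, ‖gradLogDifference i (R⁻¹ • y) ξ‖ₑ ^ 2 * ‖f y‖ₑ :=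
        lintegral_mono fun ξ => sq_enorm_integral_mul_le
          (measurable_gradLogDifference i (measurable_const_smul _) measurable_const).aemeasurable
          hf.aemeasurable
    _ = (∫⁻ y, ‖f y‖ₑ) *
          ∫⁻ y, (∫⁻ ξ in annulus n, ‖gradLogDifference i (R⁻¹ • y) ξ‖ₑ ^ 2) * ‖f y‖ₑ := by
        rw [lintegral_const_mul' _ _ hfi.2.ne, lintegral_lintegral_swap
          (f := fun ξ y => ‖gradLogDifference i (R⁻¹ • y) ξ‖ₑ ^ 2 * ‖f y‖ₑ)]
        · simp only [lintegral_mul_const' _ _ enorm_ne_top]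
        · exact (measurable_weighted_kernel R).aemeasurable

theorem integrable_gradLog_sub_mul (hn : 2 ≤ n) (i : Fin n) {f : EuclideanSpace ℝ (Fin n) → ℝ}
    (hf : Continuous f) (hfi : Integrable f) (x : EuclideanSpace ℝ (Fin n)) :
    Integrable fun y => gradLog i (y - x) * f y := by
  have integrable_bound := integrable_mul_inv_norm (μ := volume) (f := fun y => f (x + y))
    (by rwa [finrank_euclideanSpace_fin]) (by fun_prop) (hfi.comp_add_left x)
  have integrable_zero : Integrable fun y => gradLog i y * f (x + y) := by
    refine integrable_bound.norm.mono'
      ((measurable_gradLog i).mul (by fun_prop)).aestronglyMeasurable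
      (Eventually.of_forall fun y => ?_)
    rw [norm_mul, norm_mul, norm_inv, norm_norm, mul_comm]
    exact mul_le_mul_of_nonneg_left (abs_gradLog_le i y) (norm_nonneg _)
  simpa using integrable_zero.comp_sub_right x

theorem logMass_pos (hm : m ≠ 0) : 0 < logMass (2 * m) := by
  obtain ⟨k, rfl⟩ := Nat.exists_eq_succ_of_ne_zero hm
  rw [Nat.succ_eq_add_one, logMass_eq]
  have ball_pos : 0 < volume.real (Metric.ball (0 : EuclideanSpace ℝ (Fin (2 * (k + 1)))) 1) :=
    ENNReal.toReal_pos (Metric.measure_ball_pos _ _ one_pos).ne' measure_ball_lt_top.ne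
  positivity

/-- The `i`-th component at `ξ` of the difference between the gradients of the blow-down
`ξ ↦ u (R • ξ)` and of its expected limit `-α * log ‖ξ‖`. -/
noncomputable def deviation (u : EuclideanSpace ℝ (Fin n) → ℝ) (α R : ℝ) (i : Fin n)
    (ξ : EuclideanSpace ℝ (Fin n)) : ℝ :=
  partialDeriv i (rescale u 0 R) ξ + α * gradLog i ξ

/-- The coefficient `α` for which `-α * log ‖x‖` and `u` have the same total `(-Δ)ᵐ`-mass. -/
noncomputable def logCoefficient (m : ℕ) (u : EuclideanSpace ℝ (Fin (2 * m)) → ℝ) : ℝ :=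
  (∫ y, polyLaplacian m u y) / logMass (2 * m)

theorem continuousOn_gradLog (i : Fin n) : ContinuousOn (gradLog i) {0}ᶜ :=
  (EuclideanSpace.proj (𝕜 := ℝ) i).continuous.continuousOn.div
    (continuous_norm.pow 2).continuousOn fun _ hξ => pow_ne_zero 2 (norm_ne_zero_iff.2 hξ)

theorem continuousOn_deviation {u : EuclideanSpace ℝ (Fin n) → ℝ} (hu : ContDiff ℝ 1 u) (α R : ℝ)
    (i : Fin n) : ContinuousOn (deviation u α R i) {0}ᶜ :=
  (continuous_partialDeriv (contDiff_rescale hu 0 R) i).continuousOn.add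
    (continuousOn_const.mul (continuousOn_gradLog i))

theorem integrableOn_annulus {g : EuclideanSpace ℝ (Fin n) → ℝ} (hg : ContinuousOn g {0}ᶜ) :
    IntegrableOn g (annulus n) :=
  (hg.mono fun _ => ne_zero_of_mem_annulus).integrableOn_compact isCompact_annulus

variable {u : EuclideanSpace ℝ (Fin (2 * m)) → ℝ}

theorem logMass_mul_deviation (hu : ContDiff ℝ ∞ u) (hm : 2 ≤ m)
    (hF : Integrable fun z => max (confLaplacian u z) 0 ^ m)
    (hf : Integrable (polyLaplacian m u)) (i : Fin (2 * m)) {R : ℝ} (hR : 0 < R)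
    (ξ : EuclideanSpace ℝ (Fin (2 * m))) :
    logMass (2 * m) * deviation u (logCoefficient m u) R i ξ =
      ∫ y, gradLogDifference i (R⁻¹ • y) ξ * polyLaplacian m u y := by
  have gradLog_inv_smul_sub (y : EuclideanSpace ℝ (Fin (2 * m))) :
      gradLog i (R⁻¹ • y - ξ) = R * gradLog i (y - R • ξ) := by
    rw [← mul_gradLog_smul i hR, smul_sub, smul_inv_smul₀ hR.ne']
  have integrable_shifted := integrable_gradLog_sub_mul (by lia) i
    (contDiff_polyLaplacian hu m).continuous hf (R • ξ)
  simp only [gradLogDifference, gradLog_inv_smul_sub, add_mul, mul_assoc]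
  rw [integral_add (integrable_shifted.const_mul R) (hf.const_mul _), integral_const_mul,
    integral_const_mul, ← logMass_mul_partialDeriv hu hm hF hf, deviation, partialDeriv_rescale,
    Pi.smul_apply, rescale, zero_add, logCoefficient, smul_eq_mul]
  field_simp [(logMass_pos (m := m) (by lia)).ne']

theorem tendsto_setIntegral_sq_deviation (hu : ContDiff ℝ ∞ u) (hm : 2 ≤ m)
    (hF : Integrable fun z => max (confLaplacian u z) 0 ^ m)
    (hf : Integrable (polyLaplacian m u)) (i : Fin (2 * m)) :
    Tendsto (fun R => ∫ ξ in annulus (2 * m), deviation u (logCoefficient m u) R i ξ ^ 2) atTop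
      (𝓝 0) := by
  have logMass_ne_zero := (logMass_pos (m := m) (by lia)).ne'
  have tendsto_lintegral := (ENNReal.tendsto_toReal ENNReal.zero_ne_top).comp
    (tendsto_setLIntegral_sq_integral_gradLogDifference_mul (by lia) i
      (contDiff_polyLaplacian hu m).continuous.measurable hf)
  have tendsto_scaled := tendsto_lintegral.const_mul (logMass (2 * m) ^ 2)⁻¹
  rw [ENNReal.toReal_zero, mul_zero] at tendsto_scaled
  refine tendsto_scaled.congr' ?_
  filter_upwards [eventually_gt_atTop 0] with R hR
  have aestronglyMeasurable_deviation : AEStronglyMeasurable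
      (fun ξ => deviation u (logCoefficient m u) R i ξ ^ 2)
      (volume.restrict (annulus (2 * m))) :=
    (integrableOn_annulus
      ((continuousOn_deviation (contDiff_infty.1 hu 1) _ R i).pow 2)).aestronglyMeasurable
  rw [Function.comp_apply, integral_eq_lintegral_of_nonneg_ae
    (Eventually.of_forall fun _ => sq_nonneg _) aestronglyMeasurable_deviation]
  simp only [← logMass_mul_deviation hu hm hF hf i hR, enorm_mul, mul_pow]
  rw [lintegral_const_mul' _ _ (by finiteness), ENNReal.toReal_mul, ENNReal.toReal_pow,
    toReal_enorm, Real.norm_eq_abs, sq_abs, inv_mul_cancel_left₀ (pow_ne_zero 2 logMass_ne_zero)]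
  simp only [← enorm_pow, Real.enorm_of_nonneg (sq_nonneg _)]

end Asymptotics

section LpConvergence

variable {α ι : Type*} {mα : MeasurableSpace α} {μ : Measure α} {l : Filter ι}

theorem abs_integral_mul_le_sqrt_mul_sqrt {g h : α → ℝ} (hg : MemLp g 2 μ) (hh : MemLp h 2 μ) :
    |∫ x, g x * h x ∂μ| ≤ √(∫ x, g x ^ 2 ∂μ) * √(∫ x, h x ^ 2 ∂μ) := by
  have holder := integral_mul_norm_le_Lp_mul_Lq (μ := μ) (f := g) (g := h) (p := 2) (q := 2)
    (by constructor <;> norm_num) (by simpa using hg) (by simpa using hh)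
  simp only [Real.norm_eq_abs, Real.rpow_two, sq_abs, ← Real.sqrt_eq_rpow, ← abs_mul] at holder
  exact abs_integral_le_integral_abs.trans holder

theorem tendsto_integral_mul_of_tendsto_integral_sq_sub {f : ι → α → ℝ} {f₀ g : α → ℝ}
    (hf : ∀ j, MemLp (f j) 2 μ) (hf₀ : MemLp f₀ 2 μ) (hg : MemLp g 2 μ)
    (hlim : Tendsto (fun j => ∫ x, (f j x - f₀ x) ^ 2 ∂μ) l (𝓝 0)) :
    Tendsto (fun j => ∫ x, g x * f j x ∂μ) l (𝓝 (∫ x, g x * f₀ x ∂μ)) := by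
  rw [tendsto_iff_dist_tendsto_zero]
  have tendsto_bound := (hlim.sqrt).const_mul √(∫ x, g x ^ 2 ∂μ)
  rw [Real.sqrt_zero, mul_zero] at tendsto_bound
  refine squeeze_zero (fun _ => dist_nonneg) (fun j => ?_) tendsto_bound
  have integral_sub_eq : ∫ x, g x * (f j x - f₀ x) ∂μ =
      (∫ x, g x * f j x ∂μ) - ∫ x, g x * f₀ x ∂μ := by
    simp only [mul_sub]
    exact integral_sub (hg.integrable_mul (hf j)) (hg.integrable_mul hf₀)
  rw [Real.dist_eq, ← integral_sub_eq]
  exact abs_integral_mul_le_sqrt_mul_sqrt hg ((hf j).sub hf₀)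

theorem tendsto_integral_mul_sq_of_tendsto_integral_sq_sub {f : ι → α → ℝ} {f₀ g : α → ℝ}
    (hf : ∀ j, MemLp (f j) 2 μ) (hf₀ : MemLp f₀ 2 μ) (hg : AEStronglyMeasurable g μ)
    (hg₀ : ∀ x, 0 ≤ g x) (hg₁ : ∀ x, g x ≤ 1)
    (hlim : Tendsto (fun j => ∫ x, (f j x - f₀ x) ^ 2 ∂μ) l (𝓝 0)) :
    Tendsto (fun j => ∫ x, g x * f j x ^ 2 ∂μ) l (𝓝 (∫ x, g x * f₀ x ^ 2 ∂μ)) := by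
  have memLp_mul {h : α → ℝ} (hh : MemLp h 2 μ) : MemLp (fun x => g x * h x) 2 μ := by
    refine hh.of_le (hg.mul hh.1) (Eventually.of_forall fun x => ?_)
    rw [norm_mul, Real.norm_of_nonneg (hg₀ x)]
    exact mul_le_of_le_one_left (norm_nonneg _) (hg₁ x)
  have integrable_mul_mul {h k : α → ℝ} (hh : MemLp h 2 μ) (hk : MemLp k 2 μ) :
      Integrable (fun x => g x * h x * k x) μ := (memLp_mul hh).integrable_mul hk
  have tendsto_square : Tendsto (fun j => ∫ x, g x * (f j x - f₀ x) * (f j x - f₀ x) ∂μ) l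
      (𝓝 0) := by
    refine squeeze_zero (fun j => integral_nonneg fun x => ?_) (fun j => ?_) hlim
    · exact mul_assoc (g x) _ _ ▸ mul_nonneg (hg₀ x) (mul_self_nonneg _)
    · refine integral_mono (integrable_mul_mul ((hf j).sub hf₀) ((hf j).sub hf₀))
        ((hf j).sub hf₀).integrable_sq fun x => ?_
      rw [mul_assoc, ← sq]
      exact mul_le_of_le_one_left (sq_nonneg _) (hg₁ x)
  have tendsto_cross :=
    tendsto_integral_mul_of_tendsto_integral_sq_sub hf hf₀ (memLp_mul hf₀) hlim
  have integral_eq (j : ι) : ∫ x, g x * f j x ^ 2 ∂μ =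
      (∫ x, g x * (f j x - f₀ x) * (f j x - f₀ x) ∂μ) + 2 * (∫ x, g x * f₀ x * f j x ∂μ) -
        ∫ x, g x * f₀ x * f₀ x ∂μ := by
    have integrable_square : Integrable (fun x => g x * (f j x - f₀ x) * (f j x - f₀ x)) μ :=
      integrable_mul_mul ((hf j).sub hf₀) ((hf j).sub hf₀)
    have integrable_cross := (integrable_mul_mul hf₀ (hf j)).const_mul 2
    rw [← integral_const_mul, ← integral_add integrable_square integrable_cross,
      ← integral_sub (by exact integrable_square.add integrable_cross)
        (integrable_mul_mul hf₀ hf₀)]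
    exact integral_congr_ae (Eventually.of_forall fun x => by ring)
  have tendsto_sum := (tendsto_square.add (tendsto_cross.const_mul 2)).sub_const
    (∫ x, g x * f₀ x * f₀ x ∂μ)
  simp only [integral_eq]
  convert tendsto_sum using 2
  simp only [sq, ← mul_assoc]
  ring

theorem le_add_inv_pow_mul_pow {ε t : ℝ} (hε : 0 < ε) (ht : 0 ≤ t) (k : ℕ) :
    t ≤ ε + ε⁻¹ ^ k * t ^ (k + 1) := by
  rcases le_or_gt t ε with h | h
  · exact h.trans (le_add_of_nonneg_right (by positivity))
  · have one_le : 1 ≤ (ε⁻¹ * t) ^ k :=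
      one_le_pow₀ (by rw [← div_eq_inv_mul, one_le_div hε]; exact h.le)
    calc t ≤ (ε⁻¹ * t) ^ k * t := le_mul_of_one_le_left ht one_le
      _ = ε⁻¹ ^ k * t ^ (k + 1) := by rw [mul_pow]; ring
      _ ≤ ε + ε⁻¹ ^ k * t ^ (k + 1) := le_add_of_nonneg_left hε.le

theorem tendsto_integral_of_tendsto_integral_pow [IsFiniteMeasure μ] {f : ι → α → ℝ} {m : ℕ}
    (hm : m ≠ 0) (hf₀ : ∀ j x, 0 ≤ f j x) (hf : ∀ j, Integrable (f j) μ)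
    (hfm : ∀ j, Integrable (fun x => f j x ^ m) μ)
    (hlim : Tendsto (fun j => ∫ x, f j x ^ m ∂μ) l (𝓝 0)) :
    Tendsto (fun j => ∫ x, f j x ∂μ) l (𝓝 0) := by
  obtain ⟨k, rfl⟩ := Nat.exists_eq_succ_of_ne_zero hm
  have integral_le {ε : ℝ} (hε : 0 < ε) (j : ι) :
      ∫ x, f j x ∂μ ≤ ε * μ.real univ + ε⁻¹ ^ k * ∫ x, f j x ^ (k + 1) ∂μ := by
    calc ∫ x, f j x ∂μ ≤ ∫ x, (ε + ε⁻¹ ^ k * f j x ^ (k + 1)) ∂μ :=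
          integral_mono (hf j) ((integrable_const _).add ((hfm j).const_mul _))
            fun x => le_add_inv_pow_mul_pow hε (hf₀ j x) k
      _ = ε * μ.real univ + ε⁻¹ ^ k * ∫ x, f j x ^ (k + 1) ∂μ := by
          rw [integral_add (integrable_const _) ((hfm j).const_mul _), integral_const,
            integral_const_mul, smul_eq_mul, mul_comm (μ.real univ)]
  refine tendsto_order.2 ⟨fun a ha => Eventually.of_forall fun j =>
    ha.trans_le (integral_nonneg (hf₀ j)), fun η hη => ?_⟩
  obtain ⟨ε, hε, lt_η⟩ : ∃ ε, 0 < ε ∧ ε * μ.real univ < η :=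
    ⟨η / (μ.real univ + 1), by positivity, by
      rw [div_mul_eq_mul_div, div_lt_iff₀ (by positivity)]; nlinarith⟩
  have tendsto_bound := (hlim.const_mul (ε⁻¹ ^ k)).const_add (ε * μ.real univ)
  rw [mul_zero, add_zero] at tendsto_bound
  filter_upwards [tendsto_bound.eventually_lt_const lt_η] with j hj
  exact (integral_le hε j).trans_lt hj

end LpConvergence

section BlowDown

variable {n : ℕ}

theorem memLp_two_annulus {g : EuclideanSpace ℝ (Fin n) → ℝ} (hg : ContinuousOn g {0}ᶜ) :
    MemLp g 2 (volume.restrict (annulus n)) :=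
  (memLp_two_iff_integrable_sq (integrableOn_annulus hg).aestronglyMeasurable).2
    (integrableOn_annulus (hg.pow 2))

/-- A nontrivial smooth function with values in `[0, 1]` supported in the annulus. Blow-downs of
solutions, which only converge away from the origin, are tested against it. -/
structure AnnularBump (n : ℕ) where
  toFun : EuclideanSpace ℝ (Fin n) → ℝ
  contDiff : ContDiff ℝ ∞ toFun
  nonneg (ξ) : 0 ≤ toFun ξ
  le_one (ξ) : toFun ξ ≤ 1
  tsupport_subset : tsupport toFun ⊆ annulus n
  integral_pos : 0 < ∫ ξ, toFun ξ

theorem exists_annularBump (hn : n ≠ 0) : Nonempty (AnnularBump n) := by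
  set c : EuclideanSpace ℝ (Fin n) := EuclideanSpace.single ⟨0, by lia⟩ (3 / 2 : ℝ) with hc
  have norm_c : ‖c‖ = 3 / 2 := by simp [hc, PiLp.norm_single]
  let b : ContDiffBump c := ⟨1 / 4, 1 / 2, by norm_num, by norm_num⟩
  refine ⟨⟨b, b.contDiff, fun _ => b.nonneg, fun _ => b.le_one, ?_, b.integral_pos⟩⟩
  rw [b.tsupport_eq]
  intro ξ hξ
  have norm_sub_le : |‖ξ‖ - ‖c‖| ≤ 1 / 2 :=
    (abs_norm_sub_norm_le ξ c).trans (by simpa [dist_eq_norm, b] using hξ)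
  rw [abs_le] at norm_sub_le
  constructor <;> linarith

namespace AnnularBump

instance : CoeFun (AnnularBump n) fun _ => EuclideanSpace ℝ (Fin n) → ℝ := ⟨toFun⟩

variable (ψ : AnnularBump n)

theorem hasCompactSupport : HasCompactSupport ψ :=
  isCompact_annulus.of_isClosed_subset (isClosed_tsupport _) ψ.tsupport_subset

theorem eq_zero {ξ : EuclideanSpace ℝ (Fin n)} (h : ξ ∉ annulus n) : ψ ξ = 0 :=
  image_eq_zero_of_notMem_tsupport fun h' => h (ψ.tsupport_subset h')

theorem partialDeriv_eq_zero (i : Fin n) {ξ : EuclideanSpace ℝ (Fin n)} (h : ξ ∉ annulus n) :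
    partialDeriv i ψ ξ = 0 := by
  have fderiv_eq_zero : fderiv ℝ ψ ξ = 0 := Function.notMem_support.1 fun h' =>
    h (ψ.tsupport_subset (support_fderiv_subset ℝ h'))
  rw [partialDeriv, fderiv_eq_zero, zero_apply]

theorem setIntegral_annulus_mul (g : EuclideanSpace ℝ (Fin n) → ℝ) :
    ∫ ξ in annulus n, ψ ξ * g ξ = ∫ ξ, ψ ξ * g ξ :=
  setIntegral_eq_integral_of_forall_compl_eq_zero fun ξ h => by rw [ψ.eq_zero h, zero_mul]

theorem setIntegral_annulus_partialDeriv_mul (i : Fin n) (g : EuclideanSpace ℝ (Fin n) → ℝ) :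
    ∫ ξ in annulus n, partialDeriv i ψ ξ * g ξ = ∫ ξ, partialDeriv i ψ ξ * g ξ :=
  setIntegral_eq_integral_of_forall_compl_eq_zero fun ξ h => by
    rw [ψ.partialDeriv_eq_zero i h, zero_mul]

theorem integrable : Integrable ψ :=
  ψ.contDiff.continuous.integrable_of_hasCompactSupport ψ.hasCompactSupport

theorem integrable_mul {g : EuclideanSpace ℝ (Fin n) → ℝ} (hg : ContinuousOn g {0}ᶜ) :
    Integrable (fun ξ => ψ ξ * g ξ) := by
  refine (integrableOn_iff_integrable_of_support_subset fun ξ hξ => ?_).1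
    (integrableOn_annulus (ψ.contDiff.continuous.continuousOn.mul hg))
  by_contra h
  exact hξ (mul_eq_zero_of_left (ψ.eq_zero h) _)

theorem integral_mul_inv_norm_sq_pos : 0 < ∫ ξ, ψ ξ * (‖ξ‖ ^ 2)⁻¹ := by
  have continuousOn_inv : ContinuousOn (fun ξ : EuclideanSpace ℝ (Fin n) => (‖ξ‖ ^ 2)⁻¹) {0}ᶜ :=
    (continuous_norm.pow 2).continuousOn.inv₀ fun _ hξ => pow_ne_zero 2 (norm_ne_zero_iff.2 hξ)
  calc 0 < (∫ ξ, ψ ξ) * (2 ^ 2)⁻¹ := mul_pos ψ.integral_pos (by norm_num)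
    _ = ∫ ξ, ψ ξ * (2 ^ 2)⁻¹ := (integral_mul_const _ _).symm
    _ ≤ ∫ ξ, ψ ξ * (‖ξ‖ ^ 2)⁻¹ := by
        refine integral_mono (ψ.integrable.mul_const _) (ψ.integrable_mul continuousOn_inv)
          fun ξ => ?_
        by_cases hξ : ξ ∈ annulus n
        · have norm_pos := norm_pos_iff.2 (ne_zero_of_mem_annulus hξ)
          have norm_le := hξ.2
          have := ψ.nonneg ξ
          gcongr
        · simp only [ψ.eq_zero hξ, zero_mul, le_refl]

end AnnularBump

theorem sum_gradLog_sq {ξ : EuclideanSpace ℝ (Fin n)} (hξ : ξ ≠ 0) :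
    ∑ i, gradLog i ξ ^ 2 = (‖ξ‖ ^ 2)⁻¹ := by
  have norm_ne_zero := norm_ne_zero_iff.2 hξ
  simp only [gradLog, div_pow, ← Finset.sum_div, ← EuclideanSpace.real_norm_sq_eq]
  field_simp

/-- A smooth compactly supported function which, up to a constant, is `-log ‖ξ‖` on the annulus. -/
noncomputable def annularLog (n : ℕ) : EuclideanSpace ℝ (Fin n) → ℝ :=
  radial n (truncLogDiff 8 (1 / 8))

theorem contDiff_annularLog : ContDiff ℝ ∞ (annularLog n) :=
  contDiff_radial (contDiff_truncLogDiff (by norm_num) (by norm_num))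

theorem norm_sq_mem_Icc {ξ : EuclideanSpace ℝ (Fin n)} (hξ : ξ ∈ annulus n) :
    ‖ξ‖ ^ 2 ∈ Icc 1 4 := by
  have one_le := hξ.1
  have le_two := hξ.2
  constructor <;> nlinarith

theorem partialDeriv_annularLog (i : Fin n) {ξ : EuclideanSpace ℝ (Fin n)} (hξ : ξ ∈ annulus n) :
    partialDeriv i (annularLog n) ξ = -gradLog i ξ := by
  obtain ⟨one_le, le_four⟩ := norm_sq_mem_Icc hξ
  rw [annularLog, partialDeriv_radial_truncLogDiff (by norm_num) (by norm_num),
    truncLogSlope_eq_one (by linarith) (by linarith), truncLogSlope_eq_zero (by linarith),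
    sub_zero, mul_one]

theorem laplacian_annularLog {ξ : EuclideanSpace ℝ (Fin n)} (hξ : ξ ∈ annulus n) :
    Δ (annularLog n) ξ = -((n - 2) * (‖ξ‖ ^ 2)⁻¹) := by
  obtain ⟨one_le, le_four⟩ := norm_sq_mem_Icc hξ
  have radialLaplacian_eq :=
    radialPolyLaplacian_truncLogDiff (n := n) (p := 8) (q := 1 / 8) (s := ‖ξ‖ ^ 2)
      (by norm_num) (by norm_num) 1 (by linarith)
  rw [eqOn_radialPolyLaplacian isOpen_Ioo eqOn_truncLog_log 1 ⟨by linarith, by linarith⟩,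
    radialPolyLaplacian_log n 0 (show 0 < 1 / 8 * ‖ξ‖ ^ 2 by linarith),
    eqOn_radialPolyLaplacian_truncLog_zero 1 (show 2 < 8 * ‖ξ‖ ^ 2 by linarith)]
    at radialLaplacian_eq
  rw [annularLog, laplacian_radial (contDiff_infty.1
    (contDiff_truncLogDiff (by norm_num) (by norm_num)) 2), radial,
    ← neg_eq_iff_eq_neg]
  refine radialLaplacian_eq.trans ?_
  have norm_ne_zero := norm_ne_zero_iff.2 (ne_zero_of_mem_annulus hξ)
  simp only [radialLogCoeff, Finset.prod_range_zero, Pi.zero_apply]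
  simp only [pow_one, zero_add, mul_zero, sub_zero]
  field

theorem AnnularBump.sum_integral_partialDeriv_mul_gradLog (ψ : AnnularBump n) :
    ∑ i, ∫ ξ, partialDeriv i ψ ξ * gradLog i ξ = -((n - 2) * ∫ ξ, ψ ξ * (‖ξ‖ ^ 2)⁻¹) := by
  have integral_partialDeriv (i : Fin n) :
      ∫ ξ, partialDeriv i ψ ξ * partialDeriv i (annularLog n) ξ =
        -∫ ξ, partialDeriv i ψ ξ * gradLog i ξ := by
    rw [← ψ.setIntegral_annulus_partialDeriv_mul, ← ψ.setIntegral_annulus_partialDeriv_mul,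
      ← integral_neg]
    refine setIntegral_congr_fun measurableSet_annulus fun ξ hξ => ?_
    simp only [partialDeriv_annularLog i hξ, mul_neg]
  have integral_laplacian : ∫ ξ, ψ ξ * Δ (annularLog n) ξ =
      -((n - 2) * ∫ ξ, ψ ξ * (‖ξ‖ ^ 2)⁻¹) := by
    rw [← ψ.setIntegral_annulus_mul, ← ψ.setIntegral_annulus_mul, ← integral_const_mul,
      ← integral_neg]
    refine setIntegral_congr_fun measurableSet_annulus fun ξ hξ => ?_
    simp only [laplacian_annularLog hξ]
    ring
  rw [← integral_laplacian, integral_mul_laplacian (contDiff_infty.1 ψ.contDiff 1)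
    ψ.hasCompactSupport (contDiff_infty.1 contDiff_annularLog 2)]
  simp only [integral_partialDeriv, Finset.sum_neg_distrib, neg_neg]

theorem AnnularBump.integral_mul_confLaplacian (ψ : AnnularBump n)
    {w : EuclideanSpace ℝ (Fin n) → ℝ} (hw : ContDiff ℝ 2 w) :
    ∫ ξ, ψ ξ * confLaplacian w ξ =
      -(∑ i, ∫ ξ, partialDeriv i ψ ξ * partialDeriv i w ξ) +
        (n - 2) / 2 * ∑ i, ∫ ξ, ψ ξ * partialDeriv i w ξ ^ 2 := by
  have hw₁ : ContDiff ℝ 1 w := hw.of_le one_le_two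
  have integral_gradSq : ∫ ξ, ψ ξ * gradSq w ξ = ∑ i, ∫ ξ, ψ ξ * partialDeriv i w ξ ^ 2 := by
    simp only [gradSq, Finset.mul_sum]
    exact integral_finsetSum _ fun i _ =>
      ψ.integrable_mul ((continuous_partialDeriv hw₁ i).pow 2).continuousOn
  rw [← integral_mul_laplacian (contDiff_infty.1 ψ.contDiff 1) ψ.hasCompactSupport hw,
    ← integral_gradSq, ← integral_const_mul,
    ← integral_add (ψ.integrable_mul (continuous_laplacian hw).continuousOn)
      ((ψ.integrable_mul (continuous_gradSq hw₁).continuousOn).const_mul _)]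
  refine integral_congr_ae (Eventually.of_forall fun ξ => ?_)
  simp only [confLaplacian]
  ring

section Limits

variable {u : EuclideanSpace ℝ (Fin n) → ℝ} {α : ℝ} {i : Fin n}

theorem memLp_partialDeriv_rescale (hu : ContDiff ℝ 1 u) (R : ℝ) :
    MemLp (partialDeriv i (rescale u 0 R)) 2 (volume.restrict (annulus n)) :=
  memLp_two_annulus (continuous_partialDeriv (contDiff_rescale hu 0 R) i).continuousOn

theorem memLp_mul_gradLog (α : ℝ) :
    MemLp (fun ξ => -α * gradLog i ξ) 2 (volume.restrict (annulus n)) :=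
  memLp_two_annulus ((continuousOn_gradLog i).const_mul (-α))

theorem deviation_eq_sub (u : EuclideanSpace ℝ (Fin n) → ℝ) (α R : ℝ) (i : Fin n)
    (ξ : EuclideanSpace ℝ (Fin n)) :
    deviation u α R i ξ = partialDeriv i (rescale u 0 R) ξ - -α * gradLog i ξ := by
  rw [deviation, neg_mul, sub_neg_eq_add]

variable (hu : ContDiff ℝ 1 u)
  (hlim : Tendsto (fun R => ∫ ξ in annulus n, deviation u α R i ξ ^ 2) atTop (𝓝 0))

include hu hlim

theorem AnnularBump.tendsto_integral_partialDeriv_mul_partialDeriv (ψ : AnnularBump n) :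
    Tendsto (fun R => ∫ ξ, partialDeriv i ψ ξ * partialDeriv i (rescale u 0 R) ξ) atTop
      (𝓝 (-α * ∫ ξ, partialDeriv i ψ ξ * gradLog i ξ)) := by
  simp only [deviation_eq_sub] at hlim
  have tendsto_setIntegral := tendsto_integral_mul_of_tendsto_integral_sq_sub
    (memLp_partialDeriv_rescale hu) (memLp_mul_gradLog α)
    (memLp_two_annulus
      (continuous_partialDeriv (contDiff_infty.1 ψ.contDiff 1) i).continuousOn) hlim
  simpa only [ψ.setIntegral_annulus_partialDeriv_mul, mul_left_comm _ (-α),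
    integral_const_mul] using tendsto_setIntegral

theorem AnnularBump.tendsto_integral_mul_sq_partialDeriv (ψ : AnnularBump n) :
    Tendsto (fun R => ∫ ξ, ψ ξ * partialDeriv i (rescale u 0 R) ξ ^ 2) atTop
      (𝓝 (α ^ 2 * ∫ ξ, ψ ξ * gradLog i ξ ^ 2)) := by
  simp only [deviation_eq_sub] at hlim
  have tendsto_setIntegral := tendsto_integral_mul_sq_of_tendsto_integral_sq_sub
    (memLp_partialDeriv_rescale hu) (memLp_mul_gradLog α)
    ψ.contDiff.continuous.aestronglyMeasurable ψ.nonneg ψ.le_one hlim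
  simpa only [ψ.setIntegral_annulus_mul, mul_pow, neg_sq, mul_left_comm _ (α ^ 2),
    integral_const_mul] using tendsto_setIntegral

end Limits

theorem AnnularBump.tendsto_integral_confLaplacian (ψ : AnnularBump n)
    {u : EuclideanSpace ℝ (Fin n) → ℝ} (hu : ContDiff ℝ 2 u) {α : ℝ}
    (hlim : ∀ i, Tendsto (fun R => ∫ ξ in annulus n, deviation u α R i ξ ^ 2) atTop (𝓝 0)) :
    Tendsto (fun R => ∫ ξ, ψ ξ * confLaplacian (rescale u 0 R) ξ) atTop
      (𝓝 ((n - 2) / 2 * (α * (α - 2)) * ∫ ξ, ψ ξ * (‖ξ‖ ^ 2)⁻¹)) := by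
  have sum_integral_gradLog_sq :
      ∑ i, ∫ ξ, ψ ξ * gradLog i ξ ^ 2 = ∫ ξ, ψ ξ * (‖ξ‖ ^ 2)⁻¹ := by
    have integral_sum := integral_finsetSum Finset.univ fun i _ =>
      ψ.integrable_mul ((continuousOn_gradLog i).pow 2)
    simp only [Pi.pow_apply, ← Finset.mul_sum] at integral_sum
    rw [← integral_sum, ← ψ.setIntegral_annulus_mul, ← ψ.setIntegral_annulus_mul]
    refine setIntegral_congr_fun measurableSet_annulus fun ξ hξ => ?_
    simp only [sum_gradLog_sq (ne_zero_of_mem_annulus hξ)]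
  have hu₁ : ContDiff ℝ 1 u := hu.of_le one_le_two
  have tendsto_sum := ((tendsto_finsetSum Finset.univ fun i _ =>
    ψ.tendsto_integral_partialDeriv_mul_partialDeriv hu₁ (hlim i)).neg).add
    ((tendsto_finsetSum Finset.univ fun i _ =>
      ψ.tendsto_integral_mul_sq_partialDeriv hu₁ (hlim i)).const_mul (((n : ℝ) - 2) / 2))
  rw [← Finset.mul_sum, ← Finset.mul_sum, ψ.sum_integral_partialDeriv_mul_gradLog,
    sum_integral_gradLog_sq] at tendsto_sum
  simp only [ψ.integral_mul_confLaplacian (contDiff_rescale hu 0 _)]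
  convert tendsto_sum using 2
  ring

theorem setIntegral_annulus_pow_mul_comp_smul (g : EuclideanSpace ℝ (Fin n) → ℝ) {R : ℝ}
    (hR : 0 < R) : ∫ ξ in annulus n, R ^ n * g (R • ξ) =
      ∫ y, (annulus n).indicator 1 (R⁻¹ • y) * g y := by
  rw [← integral_pow_mul_comp_affine _ 0 hR, ← integral_indicator measurableSet_annulus]
  refine integral_congr_ae (Eventually.of_forall fun ξ => ?_)
  simp only [zero_add, inv_smul_smul₀ hR.ne']
  by_cases hξ : ξ ∈ annulus n <;> simp [hξ]

theorem tendsto_setIntegral_rescale {g : EuclideanSpace ℝ (Fin n) → ℝ} (hg : Integrable g) :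
    Tendsto (fun R : ℝ => ∫ ξ in annulus n, R ^ n * g (R • ξ)) atTop (𝓝 0) := by
  suffices h : Tendsto (fun R : ℝ => ∫ y, (annulus n).indicator 1 (R⁻¹ • y) * g y) atTop
      (𝓝 (∫ _ : EuclideanSpace ℝ (Fin n), 0)) by
    rw [integral_zero] at h
    exact h.congr' ((eventually_gt_atTop 0).mono fun R hR =>
      (setIntegral_annulus_pow_mul_comp_smul g hR).symm)
  have measurable_indicator :
      Measurable ((annulus n).indicator (1 : EuclideanSpace ℝ (Fin n) → ℝ)) :=
    measurable_one.indicator measurableSet_annulus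
  refine tendsto_integral_filter_of_dominated_convergence (fun y => |g y|)
    (Eventually.of_forall fun R =>
      (measurable_indicator.comp (measurable_const_smul R⁻¹)).aestronglyMeasurable.mul
        hg.aestronglyMeasurable)
    (Eventually.of_forall fun R => Eventually.of_forall fun y => ?_) hg.abs
    (Eventually.of_forall fun y => tendsto_const_nhds.congr' ?_)
  · rw [norm_mul]
    refine mul_le_of_le_one_left (abs_nonneg _) ?_
    by_cases hy : R⁻¹ • y ∈ annulus n <;> simp [hy]
  · filter_upwards [eventually_gt_atTop ‖y‖, eventually_gt_atTop 0] with R hR hR₀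
    have notMem : R⁻¹ • y ∉ annulus n := fun hmem => by
      have one_le := hmem.1
      rw [norm_smul, norm_inv, Real.norm_of_nonneg hR₀.le, ← div_eq_inv_mul,
        one_le_div hR₀] at one_le
      exact one_le.not_gt hR
    rw [indicator_of_notMem notMem, zero_mul]

theorem AnnularBump.tendsto_integral_rescale {m : ℕ} (hm : m ≠ 0) (ψ : AnnularBump (2 * m))
    {F : EuclideanSpace ℝ (Fin (2 * m)) → ℝ} (hF : Continuous F) (hF₀ : ∀ z, 0 ≤ F z)
    (hFm : Integrable fun z => F z ^ m) :
    Tendsto (fun R : ℝ => ∫ ξ, ψ ξ * (R ^ 2 * F (R • ξ))) atTop (𝓝 0) := by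
  have : IsFiniteMeasure (volume.restrict (annulus (2 * m))) :=
    isFiniteMeasure_restrict.2 isCompact_annulus.measure_ne_top
  have continuous_rescaled (R : ℝ) : Continuous fun ξ => R ^ 2 * F (R • ξ) := by fun_prop
  have nonneg_rescaled (R : ℝ) (ξ) : 0 ≤ R ^ 2 * F (R • ξ) := mul_nonneg (sq_nonneg R) (hF₀ _)
  have tendsto_pow := tendsto_setIntegral_rescale hFm
  simp only [pow_mul, ← mul_pow] at tendsto_pow
  have tendsto_setIntegral := tendsto_integral_of_tendsto_integral_pow hm nonneg_rescaled
    (fun R => integrableOn_annulus (continuous_rescaled R).continuousOn)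
    (fun R => integrableOn_annulus ((continuous_rescaled R).pow m).continuousOn) tendsto_pow
  refine squeeze_zero (fun R => integral_nonneg fun ξ =>
    mul_nonneg (ψ.nonneg ξ) (nonneg_rescaled R ξ)) (fun R => ?_) tendsto_setIntegral
  rw [← ψ.setIntegral_annulus_mul]
  exact integral_mono (ψ.integrable_mul (continuous_rescaled R).continuousOn).integrableOn
    (integrableOn_annulus (continuous_rescaled R).continuousOn)
    fun ξ => mul_le_of_le_one_left (nonneg_rescaled R ξ) (ψ.le_one ξ)

end BlowDown

section Volume

variable {n : ℕ} {α : Type*} {mα : MeasurableSpace α} {μ : Measure α}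

theorem integral_mul_exp_div_integral_le {ψ v : α → ℝ} (hψ₀ : ∀ x, 0 ≤ ψ x)
    (hψ_pos : 0 < ∫ x, ψ x ∂μ) (hψ : Integrable ψ μ) (hv : Integrable (fun x => ψ x * v x) μ)
    (hexp : Integrable (fun x => ψ x * Real.exp (v x)) μ) :
    (∫ x, ψ x ∂μ) * Real.exp ((∫ x, ψ x * v x ∂μ) / ∫ x, ψ x ∂μ) ≤
      ∫ x, ψ x * Real.exp (v x) ∂μ := by
  set c := (∫ x, ψ x * v x ∂μ) / ∫ x, ψ x ∂μ
  have tangent_le_exp (t : ℝ) : Real.exp c * (1 - c) + Real.exp c * t ≤ Real.exp t := by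
    calc Real.exp c * (1 - c) + Real.exp c * t = Real.exp c * (t - c + 1) := by ring
      _ ≤ Real.exp c * Real.exp (t - c) := by gcongr; exact Real.add_one_le_exp _
      _ = Real.exp t := by rw [← Real.exp_add, add_sub_cancel]
  have integral_mul_eq : ∫ x, ψ x * v x ∂μ = c * ∫ x, ψ x ∂μ :=
    (div_mul_cancel₀ _ hψ_pos.ne').symm
  calc (∫ x, ψ x ∂μ) * Real.exp c
      = ∫ x, (Real.exp c * (1 - c) * ψ x + Real.exp c * (ψ x * v x)) ∂μ := by
        rw [integral_add (hψ.const_mul _) (hv.const_mul _), integral_const_mul,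
          integral_const_mul, integral_mul_eq]
        ring
    _ ≤ ∫ x, ψ x * Real.exp (v x) ∂μ := by
        refine integral_mono ((hψ.const_mul _).add (hv.const_mul _)) hexp fun x => ?_
        have weighted_le := mul_le_mul_of_nonneg_left (tangent_le_exp (v x)) (hψ₀ x)
        beta_reduce
        linarith

theorem exists_eventually_le_add_mul_log {J J' : ℝ → ℝ} (hJ : ∀ R, HasDerivAt J (J' R) R)
    (hlim : Tendsto (fun R => R * J' R) atTop (𝓝 0)) {ε : ℝ} (hε : 0 < ε) :
    ∃ c, ∀ᶠ R in atTop, c ≤ J R + ε * Real.log R := by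
  obtain ⟨R₀, hR₀⟩ := eventually_atTop.1
    ((hlim.eventually_const_lt (neg_lt_zero.2 hε)).and (eventually_gt_atTop 0))
  have hasDerivAt_add_log (R : ℝ) (hR : R₀ ≤ R) :
      HasDerivAt (fun R => J R + ε * Real.log R) (J' R + ε * R⁻¹) R :=
    (hJ R).add ((Real.hasDerivAt_log (hR₀ R hR).2.ne').const_mul ε)
  have monotoneOn : MonotoneOn (fun R => J R + ε * Real.log R) (Ici R₀) := by
    refine monotoneOn_of_deriv_nonneg (convex_Ici R₀)
      (fun R hR => (hasDerivAt_add_log R hR).continuousAt.continuousWithinAt)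
      (fun R hR => (hasDerivAt_add_log R
        (interior_subset hR)).differentiableAt.differentiableWithinAt) fun R hR => ?_
    obtain ⟨neg_lt, R_pos⟩ := hR₀ R (interior_subset hR)
    rw [(hasDerivAt_add_log R (interior_subset hR)).deriv]
    calc 0 ≤ R⁻¹ * (R * J' R + ε) := mul_nonneg (inv_nonneg.2 R_pos.le) (by linarith)
      _ = J' R + ε * R⁻¹ := by field_simp
  exact ⟨_, (eventually_ge_atTop R₀).mono fun R hR => monotoneOn self_mem_Ici hR hR⟩

namespace AnnularBump

variable (ψ : AnnularBump n) {v : EuclideanSpace ℝ (Fin n) → ℝ}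

theorem hasDerivAt_integral_mul_comp_smul (hv : ContDiff ℝ 1 v) (R₀ : ℝ) :
    HasDerivAt (fun R : ℝ => ∫ ξ, ψ ξ * v (R • ξ)) (∫ ξ, ψ ξ * fderiv ℝ v (R₀ • ξ) ξ) R₀ := by
  have continuous_fderiv : Continuous fun p : ℝ × EuclideanSpace ℝ (Fin n) =>
      fderiv ℝ v (p.1 • p.2) p.2 :=
    ((hv.continuous_fderiv one_ne_zero).comp (continuous_fst.smul continuous_snd)).clm_apply
      continuous_snd
  obtain ⟨C, hC⟩ := ((isCompact_closedBall R₀ 1).prod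
    (isCompact_annulus (n := n))).exists_bound_of_continuousOn continuous_fderiv.continuousOn
  have integrable_comp (R : ℝ) : Integrable fun ξ => ψ ξ * v (R • ξ) :=
    ψ.integrable_mul (hv.continuous.comp (continuous_const_smul R)).continuousOn
  have integrable_fderiv : Integrable fun ξ => ψ ξ * fderiv ℝ v (R₀ • ξ) ξ :=
    ψ.integrable_mul (continuous_fderiv.comp (Continuous.prodMk_right R₀)).continuousOn
  refine (hasDerivAt_integral_of_dominated_loc_of_deriv_le (bound := fun ξ => ψ ξ * C)
    (F' := fun R ξ => ψ ξ * fderiv ℝ v (R • ξ) ξ) (Metric.closedBall_mem_nhds R₀ one_pos)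
    (Eventually.of_forall fun R => (integrable_comp R).aestronglyMeasurable)
    (integrable_comp R₀) integrable_fderiv.aestronglyMeasurable
    (Eventually.of_forall fun ξ R hR => ?_) (ψ.integrable.mul_const C)
    (Eventually.of_forall fun ξ R _ => ?_)).2
  · by_cases hξ : ξ ∈ annulus n
    · rw [norm_mul, Real.norm_of_nonneg (ψ.nonneg ξ)]
      exact mul_le_mul_of_nonneg_left (hC (R, ξ) ⟨hR, hξ⟩) (ψ.nonneg ξ)
    · simp [ψ.eq_zero hξ]
  · have hasDerivAt_smul : HasDerivAt (fun R : ℝ => R • ξ) ξ R := by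
      simpa using (hasDerivAt_id R).smul_const ξ
    exact ((hv.differentiable one_ne_zero (R • ξ)).hasFDerivAt.comp_hasDerivAt R
      hasDerivAt_smul).const_mul (ψ ξ)

theorem tendsto_mul_integral_mul_fderiv (hv : ContDiff ℝ 1 v)
    (hlim : ∀ i, Tendsto (fun R => ∫ ξ in annulus n, deviation v 0 R i ξ ^ 2) atTop (𝓝 0)) :
    Tendsto (fun R => R * ∫ ξ, ψ ξ * fderiv ℝ v (R • ξ) ξ) atTop (𝓝 0) := by
  have continuous_mul_coord (i : Fin n) : Continuous fun ξ => ψ ξ * ξ i :=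
    ψ.contDiff.continuous.mul (by fun_prop)
  have tendsto_component (i : Fin n) : Tendsto (fun R => ∫ ξ in annulus n,
      ψ ξ * ξ i * partialDeriv i (rescale v 0 R) ξ) atTop (𝓝 0) := by
    simpa using tendsto_integral_mul_of_tendsto_integral_sq_sub (f₀ := 0)
      (memLp_partialDeriv_rescale hv) MemLp.zero'
      (memLp_two_annulus (continuous_mul_coord i).continuousOn) (by simpa [deviation] using hlim i)
  have tendsto_sum := tendsto_finsetSum Finset.univ fun i _ => tendsto_component i
  rw [Finset.sum_const_zero] at tendsto_sum
  refine tendsto_sum.congr fun R => ?_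
  have integral_sum : ∫ ξ in annulus n, ∑ i, ψ ξ * ξ i * partialDeriv i (rescale v 0 R) ξ =
      ∑ i, ∫ ξ in annulus n, ψ ξ * ξ i * partialDeriv i (rescale v 0 R) ξ :=
    integral_finsetSum _ fun i _ => integrableOn_annulus ((continuous_mul_coord i).mul
      (continuous_partialDeriv (contDiff_rescale hv 0 R) i)).continuousOn
  rw [← integral_sum, ← ψ.setIntegral_annulus_mul, ← integral_const_mul]
  refine integral_congr_ae (Eventually.of_forall fun ξ => ?_)
  simp only [fderiv_eq_sum_partialDeriv, partialDeriv_rescale, Pi.smul_apply, rescale, zero_add,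
    smul_eq_mul, Finset.mul_sum]
  exact Finset.sum_congr rfl fun i _ => by ring

theorem pow_mul_integral_mul_exp_average_le (hv : Continuous v)
    (hexp : Integrable fun x => Real.exp (v x)) {R : ℝ} (hR : 0 < R) :
    R ^ n * ((∫ ξ, ψ ξ) * Real.exp ((∫ ξ, ψ ξ * v (R • ξ)) / ∫ ξ, ψ ξ)) ≤
      ∫ x, Real.exp (v x) := by
  have continuous_comp : Continuous fun ξ => v (R • ξ) := hv.comp (continuous_const_smul R)
  have integrable_mul_exp := ψ.integrable_mul continuous_comp.rexp.continuousOn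
  calc R ^ n * ((∫ ξ, ψ ξ) * Real.exp ((∫ ξ, ψ ξ * v (R • ξ)) / ∫ ξ, ψ ξ))
      ≤ R ^ n * ∫ ξ, ψ ξ * Real.exp (v (R • ξ)) := by
        gcongr
        exact integral_mul_exp_div_integral_le ψ.nonneg ψ.integral_pos ψ.integrable
          (ψ.integrable_mul continuous_comp.continuousOn) integrable_mul_exp
    _ = ∫ ξ, R ^ n * (ψ ξ * Real.exp (v (R • ξ))) := (integral_const_mul _ _).symm
    _ ≤ ∫ ξ, R ^ n * Real.exp (v (0 + R • ξ)) := by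
        refine integral_mono (integrable_mul_exp.const_mul _)
          (integrable_pow_mul_comp_affine hexp 0 hR.ne') fun ξ => ?_
        simp only [zero_add]
        gcongr
        exact mul_le_of_le_one_left (Real.exp_pos _).le (ψ.le_one ξ)
    _ = ∫ x, Real.exp (v x) := integral_pow_mul_comp_affine (fun x => Real.exp (v x)) 0 hR

end AnnularBump

theorem not_integrable_exp_of_tendsto_deviation (hn : n ≠ 0) {u : EuclideanSpace ℝ (Fin n) → ℝ}
    (hu : ContDiff ℝ 1 u)
    (hlim : ∀ i, Tendsto (fun R => ∫ ξ in annulus n, deviation u 0 R i ξ ^ 2) atTop (𝓝 0)) :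
    ¬ Integrable fun x => Real.exp (n * u x) := by
  intro hexp
  obtain ⟨ψ⟩ := exists_annularBump hn
  have mass_pos := ψ.integral_pos
  set s := ∫ ξ, ψ ξ
  obtain ⟨c, hc⟩ := exists_eventually_le_add_mul_log (ψ.hasDerivAt_integral_mul_comp_smul hu)
    (ψ.tendsto_mul_integral_mul_fderiv hu hlim) (half_pos mass_pos)
  have tendsto_lower : Tendsto (fun R => s * Real.exp (n * (c / s + Real.log R / 2))) atTop atTop :=
    (Real.tendsto_exp_atTop.comp ((tendsto_atTop_add_const_left _ _
      (Real.tendsto_log_atTop.atTop_div_const two_pos)).const_mul_atTop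
        (by positivity))).const_mul_atTop mass_pos
  refine not_tendsto_const_atTop (∫ x, Real.exp (n * u x)) atTop
    (tendsto_atTop_mono' _ ?_ tendsto_lower)
  filter_upwards [hc, eventually_gt_atTop 0] with R le_average hR
  have integral_mul_eq : ∫ ξ, ψ ξ * (n * u (R • ξ)) = n * ∫ ξ, ψ ξ * u (R • ξ) := by
    simp only [mul_left_comm _ (n : ℝ), integral_const_mul]
  have div_le : c / s ≤ (∫ ξ, ψ ξ * u (R • ξ)) / s + Real.log R / 2 := by
    rw [div_le_iff₀ mass_pos, add_mul, div_mul_cancel₀ _ mass_pos.ne']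
    linarith
  calc s * Real.exp (n * (c / s + Real.log R / 2))
      ≤ s * Real.exp (n * ((∫ ξ, ψ ξ * u (R • ξ)) / s + Real.log R / 2 + Real.log R / 2)) := by
        gcongr
    _ = R ^ n * (s * Real.exp ((∫ ξ, ψ ξ * (n * u (R • ξ))) / s)) := by
        rw [integral_mul_eq, add_assoc, add_halves, mul_add, Real.exp_add,
          Real.exp_nat_mul (Real.log R), Real.exp_log hR, mul_div_assoc]
        ring
    _ ≤ ∫ x, Real.exp (n * u x) :=
        ψ.pow_mul_integral_mul_exp_average_le (continuous_const.mul hu.continuous) hexp hR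

end Volume

section TotalCurvature

variable {m : ℕ} {u : EuclideanSpace ℝ (Fin (2 * m)) → ℝ}

theorem integrable_max_pow_of_integrable_abs_pow {α : Type*} {mα : MeasurableSpace α}
    {μ : Measure α} {K : α → ℝ} (hK : AEMeasurable K μ) (h : Integrable (fun z => |K z| ^ m) μ) :
    Integrable (fun z => max (K z) 0 ^ m) μ := by
  refine h.mono' ((hK.max aemeasurable_const).pow_const m).aestronglyMeasurable
    (Eventually.of_forall fun z => ?_)
  rw [norm_pow, Real.norm_of_nonneg (le_max_right _ _)]
  exact pow_le_pow_left₀ (le_max_right _ _) (max_le (le_abs_self _) (abs_nonneg _)) m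

theorem logCoefficient_mul_sub_two_nonpos (hu : ContDiff ℝ ∞ u) (hm : 2 ≤ m)
    (hF : Integrable fun z => max (confLaplacian u z) 0 ^ m) (hf : Integrable (polyLaplacian m u)) :
    logCoefficient m u * (logCoefficient m u - 2) ≤ 0 := by
  have hu₂ : ContDiff ℝ 2 u := contDiff_infty.1 hu 2
  obtain ⟨ψ⟩ := exists_annularBump (n := 2 * m) (by lia)
  have continuous_max : Continuous fun z => max (confLaplacian u z) 0 :=
    (continuous_confLaplacian hu₂).max continuous_const
  have limit_nonpos := le_of_tendsto_of_tendsto'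
    (ψ.tendsto_integral_confLaplacian hu₂ (tendsto_setIntegral_sq_deviation hu hm hF hf))
    (ψ.tendsto_integral_rescale (by lia) continuous_max (fun _ => le_max_right _ _) hF)
    fun R => by
      refine integral_mono
        (ψ.integrable_mul (continuous_confLaplacian (contDiff_rescale hu₂ 0 R)).continuousOn)
        (ψ.integrable_mul (continuous_const.mul
          (continuous_max.comp (continuous_const_smul R))).continuousOn) fun ξ => ?_
      simp only [confLaplacian_rescale hu₂, zero_add]
      have := ψ.nonneg ξ
      gcongr
      exact le_max_left _ _
  have dim_pos : (0 : ℝ) < ((2 * m : ℕ) - 2) / 2 := by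
    have : (2 : ℝ) ≤ m := mod_cast hm
    push_cast
    linarith
  exact nonpos_of_mul_nonpos_right
    (nonpos_of_mul_nonpos_left limit_nonpos ψ.integral_mul_inv_norm_sq_pos) dim_pos

theorem logCoefficient_mul_sub_two_eq_zero (hu : ContDiff ℝ ∞ u) (hm : 2 ≤ m)
    (hK : Integrable fun z => |confLaplacian u z| ^ m) (hf : Integrable (polyLaplacian m u)) :
    logCoefficient m u * (logCoefficient m u - 2) = 0 := by
  have hu₂ : ContDiff ℝ 2 u := contDiff_infty.1 hu 2
  obtain ⟨ψ⟩ := exists_annularBump (n := 2 * m) (by lia)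
  have hF := integrable_max_pow_of_integrable_abs_pow
    (continuous_confLaplacian hu₂).measurable.aemeasurable hK
  have tendsto_zero : Tendsto (fun R => ∫ ξ, ψ ξ * confLaplacian (rescale u 0 R) ξ) atTop
      (𝓝 0) := by
    refine squeeze_zero_norm (fun R => ?_) (ψ.tendsto_integral_rescale (by lia)
      (continuous_confLaplacian hu₂).abs (fun _ => abs_nonneg _) hK)
    refine (norm_integral_le_integral_norm _).trans_eq (integral_congr_ae
      (Eventually.of_forall fun ξ => ?_))
    simp only [confLaplacian_rescale hu₂, zero_add, norm_mul, Real.norm_eq_abs,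
      abs_of_nonneg (ψ.nonneg ξ), abs_sq]
  have limit_eq_zero := tendsto_nhds_unique (ψ.tendsto_integral_confLaplacian hu₂
    (tendsto_setIntegral_sq_deviation hu hm hF hf)) tendsto_zero
  have dim_ne_zero : (((2 * m : ℕ) : ℝ) - 2) / 2 ≠ 0 := by
    have : (2 : ℝ) ≤ m := mod_cast hm
    push_cast
    linarith
  exact (mul_eq_zero.1 ((mul_eq_zero.1 limit_eq_zero).resolve_right
    ψ.integral_mul_inv_norm_sq_pos.ne')).resolve_left dim_ne_zero

theorem logCoefficient_mem_Icc (hu : ContDiff ℝ ∞ u) (hm : 2 ≤ m)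
    (hF : Integrable fun z => max (confLaplacian u z) 0 ^ m) (hf : Integrable (polyLaplacian m u)) :
    logCoefficient m u ∈ Icc 0 2 := by
  have nonpos := logCoefficient_mul_sub_two_nonpos hu hm hF hf
  constructor <;> nlinarith

theorem logCoefficient_eq_zero_or_eq_two (hu : ContDiff ℝ ∞ u) (hm : 2 ≤ m)
    (hK : Integrable fun z => |confLaplacian u z| ^ m) (hf : Integrable (polyLaplacian m u)) :
    logCoefficient m u = 0 ∨ logCoefficient m u = 2 :=
  (mul_eq_zero.1 (logCoefficient_mul_sub_two_eq_zero hu hm hK hf)).imp_right sub_eq_zero.1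

theorem logCoefficient_eq_two (hu : ContDiff ℝ ∞ u) (hm : 2 ≤ m)
    (hK : Integrable fun z => |confLaplacian u z| ^ m) (hf : Integrable (polyLaplacian m u))
    (hvol : Integrable fun x => Real.exp ((2 * m : ℕ) * u x)) : logCoefficient m u = 2 := by
  refine (logCoefficient_eq_zero_or_eq_two hu hm hK hf).resolve_left fun eq_zero => ?_
  have hF := integrable_max_pow_of_integrable_abs_pow
    (continuous_confLaplacian (contDiff_infty.1 hu 2)).measurable.aemeasurable hK
  exact not_integrable_exp_of_tendsto_deviation (by lia) (contDiff_infty.1 hu 1)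
    (eq_zero ▸ tendsto_setIntegral_sq_deviation hu hm hF hf) hvol

theorem integral_polyLaplacian_eq (hm : m ≠ 0) (u : EuclideanSpace ℝ (Fin (2 * m)) → ℝ) :
    ∫ x, polyLaplacian m u x = logCoefficient m u * logMass (2 * m) :=
  (div_mul_cancel₀ _ (logMass_pos hm).ne').symm

theorem factorial_mul_sphereVolume (n : ℕ) :
    ((n - 1).factorial : ℝ) * sphereVolume n = 2 * logMass n := by
  rw [logMass]
  ring

theorem qCurvature_mul_exp (x : EuclideanSpace ℝ (Fin (2 * m))) :
    qCurvature u x * Real.exp ((2 * m : ℕ) * u x) = polyLaplacian m u x := by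
  rw [qCurvature, Nat.mul_div_cancel_left m two_pos, mul_assoc, ← Real.exp_add]
  simp [polyLaplacian]

theorem exp_neg_mul_pow_mul_exp (m : ℕ) (a t : ℝ) :
    (Real.exp (-(2 * t)) * a) ^ m * Real.exp ((2 * m : ℕ) * t) = a ^ m := by
  have exp_mul_exp : Real.exp (-(2 * t)) ^ m * Real.exp ((2 * m : ℕ) * t) = 1 := by
    rw [← Real.exp_nat_mul, ← Real.exp_add, Real.exp_eq_one_iff]
    push_cast
    ring
  rw [mul_pow, mul_right_comm, exp_mul_exp, one_mul]

theorem two_mul_cast_sub_one_pos (hm : m ≠ 0) : (0 : ℝ) < 2 * ((2 * m : ℕ) - 1) := by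
  have : (1 : ℝ) ≤ m := mod_cast Nat.one_le_iff_ne_zero.2 hm
  push_cast
  linarith

theorem max_neg_scalarCurvature_pow_mul_exp (hu : ContDiff ℝ 2 u) (hm : m ≠ 0)
    (x : EuclideanSpace ℝ (Fin (2 * m))) :
    max (-(scalarCurvature (conformalMetric u) x)) 0 ^ (2 * m / 2) *
        Real.exp ((2 * m : ℕ) * u x) =
      (2 * ((2 * m : ℕ) - 1)) ^ m * max (confLaplacian u x) 0 ^ m := by
  have const_pos := two_mul_cast_sub_one_pos hm
  have max_mul (c : ℝ) (hc : 0 ≤ c) :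
      max (c * confLaplacian u x) 0 = c * max (confLaplacian u x) 0 := by
    rw [mul_max_of_nonneg _ _ hc, mul_zero]
  rw [scalarCurvature_conformalMetric hu, Nat.mul_div_cancel_left m two_pos, neg_mul, neg_mul,
    neg_neg, max_mul _ (by positivity), mul_assoc, mul_pow, mul_assoc, exp_neg_mul_pow_mul_exp]

theorem abs_scalarCurvature_pow_mul_exp (hu : ContDiff ℝ 2 u) (hm : m ≠ 0)
    (x : EuclideanSpace ℝ (Fin (2 * m))) :
    |scalarCurvature (conformalMetric u) x| ^ (2 * m / 2) * Real.exp ((2 * m : ℕ) * u x) =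
      (2 * ((2 * m : ℕ) - 1)) ^ m * |confLaplacian u x| ^ m := by
  rw [scalarCurvature_conformalMetric hu, Nat.mul_div_cancel_left m two_pos, neg_mul, neg_mul,
    abs_neg, abs_mul, abs_mul, Real.abs_exp, abs_of_pos (two_mul_cast_sub_one_pos hm), mul_assoc,
    mul_pow, mul_assoc, exp_neg_mul_pow_mul_exp]

end TotalCurvature

end ConformalQ

theorem mainTheorem6 (n : ℕ) (hn : 4 ≤ n) (hn_even : Even n)
    (u : EuclideanSpace ℝ (Fin n) → ℝ) (hu : ContDiff ℝ ∞ u)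
    (hQ : Integrable (fun x => ConformalQ.qCurvature u x * Real.exp (n * u x))) :
    (Integrable (fun x =>
        (max (-(ConformalQ.scalarCurvature (ConformalQ.conformalMetric u) x)) 0) ^ (n / 2)
          * Real.exp (n * u x)) →
      0 ≤ ∫ x, ConformalQ.qCurvature u x * Real.exp (n * u x) ∧
      ∫ x, ConformalQ.qCurvature u x * Real.exp (n * u x)
        ≤ ((n - 1).factorial : ℝ) * ConformalQ.sphereVolume n) ∧
    (Integrable (fun x =>
        |ConformalQ.scalarCurvature (ConformalQ.conformalMetric u) x| ^ (n / 2)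
          * Real.exp (n * u x)) →
      (∫ x, ConformalQ.qCurvature u x * Real.exp (n * u x) = 0 ∨
        ∫ x, ConformalQ.qCurvature u x * Real.exp (n * u x)
          = ((n - 1).factorial : ℝ) * ConformalQ.sphereVolume n) ∧
      (Integrable (fun x => Real.exp (n * u x)) →
        ∫ x, ConformalQ.qCurvature u x * Real.exp (n * u x)
          = ((n - 1).factorial : ℝ) * ConformalQ.sphereVolume n)) := by
  obtain ⟨m, rfl⟩ : ∃ m, n = 2 * m := even_iff_exists_two_mul.1 hn_even
  have hm : 2 ≤ m := by lia
  have hm₀ : m ≠ 0 := by lia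
  have hu₂ : ContDiff ℝ 2 u := contDiff_infty.1 hu 2
  have logMass_pos := ConformalQ.logMass_pos hm₀
  have isUnit_const : IsUnit ((2 * (((2 * m : ℕ) : ℝ) - 1)) ^ m) :=
    (pow_pos (ConformalQ.two_mul_cast_sub_one_pos hm₀) m).ne'.isUnit
  simp only [ConformalQ.qCurvature_mul_exp, ConformalQ.integral_polyLaplacian_eq hm₀,
    ConformalQ.max_neg_scalarCurvature_pow_mul_exp hu₂ hm₀,
    ConformalQ.abs_scalarCurvature_pow_mul_exp hu₂ hm₀,
    ConformalQ.factorial_mul_sphereVolume, integrable_const_mul_iff isUnit_const] at hQ ⊢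
  refine ⟨fun hF => ?_, fun hK => ⟨?_, fun hvol => ?_⟩⟩
  · obtain ⟨nonneg, le_two⟩ := ConformalQ.logCoefficient_mem_Icc hu hm hF hQ
    exact ⟨mul_nonneg nonneg logMass_pos.le, mul_le_mul_of_nonneg_right le_two logMass_pos.le⟩
  · exact (ConformalQ.logCoefficient_eq_zero_or_eq_two hu hm hK hQ).imp
      (fun eq_zero => by rw [eq_zero, zero_mul]) fun eq_two => by rw [eq_two]
  · rw [ConformalQ.logCoefficient_eq_two hu hm hK hQ hvol]
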